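/- Let $\theta\in[0,2\pi)\setminus\{0,\frac{\pi}{2},\pi,\frac{3\pi}{2}\}$, $\theta_1\in[0,2\pi)$, and $\alpha,\beta\in\mathbb{C}$ with $|\alpha|^2+|\beta|^2=1$; put $c=\cos\theta$, $s=\sin\theta$, $c_1=\cos\theta_1$, $s_1=\sin\theta_1$. For $\tau\in\{1,2,\dots\}$ consider the quantum walk on $\mathbb{Z}$ with amplitudes $\psi_t(x)\in\mathbb{C}^2$ given by $\psi_0(0)={}^T[\alpha,\beta]$, $\psi_0(x)=0$ for $x\ne 0$, and $$\psi_{t+1}(x)=\begin{cases}P\,\psi_t(x+1)+Q\,\psi_t(x-1)&(t\neq\tau),\\ P_1\,\psi_t(x+1)+Q_1\,\psi_t(x-1)&(t=\tau),\end{cases}$$ where $P=\begin{bmatrix}c&s\\0&0\end{bmatrix}$, $Q=\begin{bmatrix}0&0\\s&-c\end{bmatrix}$, $P_1=\begin{bmatrix}c_1&s_1\\0&0\end{bmatrix}$, $Q_1=\begin{bmatrix}0&0\\s_1&-c_1\end{bmatrix}$. The position $X_t$ at time $t$ has the law $P(X_t=x)=\|\psi_t(x)\|^2$. Let $t\to\infty$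 with $t\in\{2\tau+1,2\tau+2\}$ (so that $\tau\to\infty$ with $t$). Then $X_t/t$ converges in distribution to the probability measure $\Delta\,\delta_0+f(x)\,dx$, where $\delta_0$ is the unit mass at the origin and $$f(x)=\frac{|s|}{\pi(1-x^2)\sqrt{c^2-x^2}}\left[1-\left\{|\alpha|^2-|\beta|^2+\frac{(\alpha\overline{\beta}+\overline{\alpha}\beta)s}{c}\right\}x\right]\frac{a_2x^4+a_1x^2+a_0}{c^2(1-x^2)}\,I_{(-|c|,|c|)}(x)$$ is nonnegative and integrable ($I_A$ is the indicator function of $A$), with $$\Delta=\frac{(c_1s-s_1c)^2}{1+|s|},\quad a_0=c^2,\quad a_1=2s_1c(c_1s-s_1c)-c_1^2,\quad a_2=(c_1s-s_1c)^2,$$ which do not depend on the initial state. Equivalently, for every real $x\neq0$ (and also for $x=0$ if $\Delta=0$), $$\lim_{t\to\infty}P(X_t/t\le x)=\Delta\, I_{[0,\infty)}(x)+\int_{-\infty}^x f(y)\,dy.$$ In particular, if $\theta_1=\theta$, then $\Delta=0$ and $f$ is the limit density of the usual walk, $$f(x)=\frac{|s|}{\pi(1-x^2)\sqrt{c^2-x^2}}\left[1-\left\{|\alpha|^2-|\beta|^2+\frac{(\alpha\overline{\beta}+\overline{\alpha}\beta)s}{c}\right\}x\right]I_{(-|c|,|c|)}(x).$$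 -/

import Mathlib

open MeasureTheory ProbabilityTheory Filter Topology Matrix

noncomputable section

namespace HalfTimeQW

/-- The coin matrix with rows `(cos φ, sin φ)` and `(sin φ, -cos φ)`. -/
def coin (φ : ℝ) : Matrix (Fin 2) (Fin 2) ℂ :=
  !![(Real.cos φ : ℂ), (Real.sin φ : ℂ); (Real.sin φ : ℂ), -(Real.cos φ : ℂ)]

/-- The upper row of the coin (a step to the left). -/
def coinP (φ : ℝ) : Matrix (Fin 2) (Fin 2) ℂ :=
  !![(Real.cos φ : ℂ), (Real.sin φ : ℂ); 0, 0]

/-- The lower row of the coin (a step to the right). -/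
def coinQ (φ : ℝ) : Matrix (Fin 2) (Fin 2) ℂ :=
  !![0, 0; (Real.sin φ : ℂ), -(Real.cos φ : ℂ)]

theorem coinP_add_coinQ (φ : ℝ) : coinP φ + coinQ φ = coin φ := by
  ext i j
  fin_cases i <;> fin_cases j <;> simp [coin, coinP, coinQ]

/-- The amplitude `ψ_t(x) ∈ ℂ²` of the walk with initial state `(α, β)` at the origin: the coin of
angle `θ₁` is used in the step from time `τ` to time `τ + 1`, the coin of angle `θ` in all other
steps. -/
def amplitude (θ θ₁ : ℝ) (α β : ℂ) (τ : ℕ) : ℕ → ℤ → (Fin 2 → ℂ)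
  | 0, x => if x = 0 then ![α, β] else 0
  | t + 1, x =>
    if t = τ then
      coinP θ₁ *ᵥ amplitude θ θ₁ α β τ t (x + 1) + coinQ θ₁ *ᵥ amplitude θ θ₁ α β τ t (x - 1)
    else
      coinP θ *ᵥ amplitude θ θ₁ α β τ t (x + 1) + coinQ θ *ᵥ amplitude θ θ₁ α β τ t (x - 1)

/-- `P(X_t = x) = ⟨ψ_t(x)|ψ_t(x)⟩`, the squared Euclidean norm of the amplitude. -/
def prob (θ θ₁ : ℝ) (α β : ℂ) (τ t : ℕ) (x : ℤ) : ℝ :=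
  ∑ i, ‖amplitude θ θ₁ α β τ t x i‖ ^ 2

/-- The law of the position `X_t`, the measure on `ℤ` with point masses `P(X_t = x)`. -/
def walkLaw (θ θ₁ : ℝ) (α β : ℂ) (τ t : ℕ) : Measure ℤ :=
  Measure.sum fun x : ℤ => ENNReal.ofReal (prob θ θ₁ α β τ t x) • Measure.dirac x

/-- The mass `Δ` of the limit law at the origin. -/
def atom (θ θ₁ : ℝ) : ℝ :=
  (Real.cos θ₁ * Real.sin θ - Real.sin θ₁ * Real.cos θ) ^ 2 / (1 + |Real.sin θ|)

def a₀ (θ : ℝ) : ℝ := Real.cos θ ^ 2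

def a₁ (θ θ₁ : ℝ) : ℝ :=
  2 * Real.sin θ₁ * Real.cos θ * (Real.cos θ₁ * Real.sin θ - Real.sin θ₁ * Real.cos θ)
    - Real.cos θ₁ ^ 2

def a₂ (θ θ₁ : ℝ) : ℝ :=
  (Real.cos θ₁ * Real.sin θ - Real.sin θ₁ * Real.cos θ) ^ 2

/-- The limit density of the usual walk, with the coin of angle `θ` in all steps. -/
def usualDensity (θ : ℝ) (α β : ℂ) : ℝ → ℝ :=
  (Set.Ioo (-|Real.cos θ|) |Real.cos θ|).indicator fun x =>
    |Real.sin θ| / (Real.pi * (1 - x ^ 2) * √(Real.cos θ ^ 2 - x ^ 2)) *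
      (1 - (‖α‖ ^ 2 - ‖β‖ ^ 2
        + (α * starRingEnd ℂ β + starRingEnd ℂ α * β).re * Real.sin θ / Real.cos θ) * x)

/-- The absolutely continuous part of the limit density. -/
def density (θ θ₁ : ℝ) (α β : ℂ) : ℝ → ℝ :=
  (Set.Ioo (-|Real.cos θ|) |Real.cos θ|).indicator fun x =>
    |Real.sin θ| / (Real.pi * (1 - x ^ 2) * √(Real.cos θ ^ 2 - x ^ 2)) *
      (1 - (‖α‖ ^ 2 - ‖β‖ ^ 2
        + (α * starRingEnd ℂ β + starRingEnd ℂ α * β).re * Real.sin θ / Real.cos θ) * x) *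
      ((a₂ θ θ₁ * x ^ 4 + a₁ θ θ₁ * x ^ 2 + a₀ θ) / (Real.cos θ ^ 2 * (1 - x ^ 2)))

/-- The limit law `Δ δ₀ + density(x) dx`. -/
def limitLaw (θ θ₁ : ℝ) (α β : ℂ) : Measure ℝ :=
  ENNReal.ofReal (atom θ θ₁) • Measure.dirac 0
    + volume.withDensity fun x => ENNReal.ofReal (density θ θ₁ α β x)

end HalfTimeQW

end

open HalfTimeQW

open HalfTimeQW

/-! In Fourier space one step of the walk is multiplication by the unitary 2×2 matrix `stepMatrix`,
and the characteristic function of `X_t / t` at `ξ` is the mean over momenta `k` of the overlap of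
the Fourier amplitude at `k` with the one at `k - ξ / t` (`charFun_map_walkLaw`). For the coin `θ`
there are two branches of sign `σ = ±1`; since the derivative of the phase is `σ * vel θ k`, a wave
packet on branch `σ` travels at velocity `-σ * vel θ k`.

The exceptional coin cuts the evolution into two stretches of asymptotically equal length. A state
starts on branch `l`, the coin `θ₁` sends it to branch `j`, and it stays there; thus the amplitude
is a sum of four terms indexed by `(j, l)`. In the overlap, terms with different `j` are orthogonal
in the limit, and terms with equal `j` and different `l` carry a phase `±2 τ freq θ k` and vanish by
Riemann–Lebesgue. Only diagonal terms survive (`tendsto_integral_branch_term`). If `j = l`, the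
packet keeps its velocity; if `j ≠ l`, the second stretch undoes the first, and the packet returns
to the origin on the scale `t`. This return is the source of the atom.

The switch has probability `switchProb θ θ₁ k` on either branch, independently of the initial state.
Its mean over `k` is `atom θ θ₁` (`integral_switchProb`). The remaining mass, weighted by the
initial occupation of the branches, becomes `density` under the substitution `x = vel θ k`
(`abs_deriv_mul_density`). Lévy's continuity theorem converts the limit of characteristic functions
into convergence in distribution, and the portmanteau theorem gives the distribution functions. -/

namespace HalfTimeQW

/-! ### Conservation of probability and the law of the position -/

section Walk

variable (θ θ₁ : ℝ) (α β : ℂ) (τ : ℕ)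

/-- The angle of the coin used in the step from time `t` to time `t + 1`. -/
noncomputable def coinAngle (t : ℕ) : ℝ := if t = τ then θ₁ else θ

theorem amplitude_succ (t : ℕ) (x : ℤ) :
    amplitude θ θ₁ α β τ (t + 1) x =
      coinP (coinAngle θ θ₁ τ t) *ᵥ amplitude θ θ₁ α β τ t (x + 1) +
        coinQ (coinAngle θ θ₁ τ t) *ᵥ amplitude θ θ₁ α β τ t (x - 1) := by
  rw [amplitude, coinAngle]
  split_ifs <;> rfl

theorem amplitude_succ_zero (t : ℕ) (x : ℤ) :
    amplitude θ θ₁ α β τ (t + 1) x 0 =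
      (Real.cos (coinAngle θ θ₁ τ t) : ℂ) * amplitude θ θ₁ α β τ t (x + 1) 0 +
        (Real.sin (coinAngle θ θ₁ τ t) : ℂ) * amplitude θ θ₁ α β τ t (x + 1) 1 := by
  simp [amplitude_succ, coinP, coinQ, dotProduct, Fin.sum_univ_two]

theorem amplitude_succ_one (t : ℕ) (x : ℤ) :
    amplitude θ θ₁ α β τ (t + 1) x 1 =
      (Real.sin (coinAngle θ θ₁ τ t) : ℂ) * amplitude θ θ₁ α β τ t (x - 1) 0 -
        (Real.cos (coinAngle θ θ₁ τ t) : ℂ) * amplitude θ θ₁ α β τ t (x - 1) 1 := by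
  simp [amplitude_succ, coinP, coinQ, dotProduct, Fin.sum_univ_two]
  ring

/-- Finite propagation speed: one site per step. It makes every Fourier sum and every expectation
below a finite sum. -/
theorem amplitude_eq_zero (t : ℕ) (x : ℤ) (hx : (t : ℤ) < |x|) (i : Fin 2) :
    amplitude θ θ₁ α β τ t x i = 0 := by
  induction t generalizing x i with
  | zero =>
    have : x ≠ 0 := by rintro rfl; simp at hx
    simp [amplitude, this]
  | succ t ih =>
    have h1 : (t : ℤ) < |x + 1| := by grind
    have h2 : (t : ℤ) < |x - 1| := by grind
    fin_cases i
    · simp [amplitude_succ_zero, ih _ h1]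
    · simp [amplitude_succ_one, ih _ h2]

theorem prob_nonneg (t : ℕ) (x : ℤ) : 0 ≤ prob θ θ₁ α β τ t x :=
  Finset.sum_nonneg fun _ _ => by positivity

theorem norm_sq_rotation_add (φ : ℝ) (a b : ℂ) :
    ‖(Real.cos φ : ℂ) * a + (Real.sin φ : ℂ) * b‖ ^ 2 +
      ‖(Real.sin φ : ℂ) * a - (Real.cos φ : ℂ) * b‖ ^ 2 = ‖a‖ ^ 2 + ‖b‖ ^ 2 := by
  simp only [← Complex.normSq_eq_norm_sq, Complex.normSq_apply, Complex.add_re, Complex.add_im,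
    Complex.sub_re, Complex.sub_im, Complex.re_ofReal_mul, Complex.im_ofReal_mul]
  linear_combination (a.re ^ 2 + a.im ^ 2 + b.re ^ 2 + b.im ^ 2) * Real.sin_sq_add_cos_sq φ

/-- The coin is orthogonal at each site, and the shift only moves the upper components one site left
and the lower ones one site right; neither changes the total squared norm. -/
theorem hasSum_prob (hαβ : ‖α‖ ^ 2 + ‖β‖ ^ 2 = 1) (t : ℕ) :
    HasSum (prob θ θ₁ α β τ t) 1 := by
  induction t with
  | zero =>
    have : prob θ θ₁ α β τ 0 0 = 1 := by simpa [prob, amplitude] using hαβ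
    rw [← this]
    refine hasSum_single 0 fun x hx => ?_
    simp [prob, amplitude, hx]
  | succ t ih =>
    set f : ℤ → ℝ := fun x => ‖(Real.cos (coinAngle θ θ₁ τ t) : ℂ) * amplitude θ θ₁ α β τ t x 0 +
      (Real.sin (coinAngle θ θ₁ τ t) : ℂ) * amplitude θ θ₁ α β τ t x 1‖ ^ 2 with hf
    set g : ℤ → ℝ := fun x => ‖(Real.sin (coinAngle θ θ₁ τ t) : ℂ) * amplitude θ θ₁ α β τ t x 0 -
      (Real.cos (coinAngle θ θ₁ τ t) : ℂ) * amplitude θ θ₁ α β τ t x 1‖ ^ 2 with hg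
    have hfg : ∀ x, f x + g x = prob θ θ₁ α β τ t x := fun x => by
      simp only [hf, hg, prob, Fin.sum_univ_two, norm_sq_rotation_add]
    have hf0 : ∀ x, 0 ≤ f x := fun x => by positivity
    have hg0 : ∀ x, 0 ≤ g x := fun x => by positivity
    have hfs : Summable f := ih.summable.of_nonneg_of_le hf0 fun x => by linarith [hfg x, hg0 x]
    have hgs : Summable g := ih.summable.of_nonneg_of_le hg0 fun x => by linarith [hfg x, hf0 x]
    have h1 : ∑' x, f x + ∑' x, g x = 1 := by
      rw [← hfs.tsum_add hgs, ← ih.tsum_eq]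
      exact tsum_congr hfg
    have h2 : HasSum (fun x => f (x + 1) + g (x - 1)) (∑' x, f x + ∑' x, g x) :=
      ((Equiv.addRight (1 : ℤ)).hasSum_iff.2 hfs.hasSum).add
        ((Equiv.subRight (1 : ℤ)).hasSum_iff.2 hgs.hasSum)
    rw [h1] at h2
    convert! h2 using 1
    funext x
    simp only [hf, hg, prob, Fin.sum_univ_two, amplitude_succ_zero, amplitude_succ_one]

theorem walkLaw_singleton (t : ℕ) (x : ℤ) :
    walkLaw θ θ₁ α β τ t {x} = ENNReal.ofReal (prob θ θ₁ α β τ t x) := by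
  rw [walkLaw, Measure.sum_apply _ (measurableSet_singleton x), tsum_eq_single x]
  · simp
  · intro y hy
    simp [hy]

theorem isProbabilityMeasure_walkLaw (hαβ : ‖α‖ ^ 2 + ‖β‖ ^ 2 = 1) (t : ℕ) :
    IsProbabilityMeasure (walkLaw θ θ₁ α β τ t) := by
  constructor
  rw [walkLaw, Measure.sum_apply _ MeasurableSet.univ]
  have h := hasSum_prob θ θ₁ α β τ hαβ t
  simp only [Measure.smul_apply, measure_univ, smul_eq_mul, mul_one]
  rw [← ENNReal.ofReal_tsum_of_nonneg (prob_nonneg θ θ₁ α β τ t) h.summable, h.tsum_eq,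
    ENNReal.ofReal_one]

/-! ### Fourier transform and the characteristic function -/

/-- The coin of angle `φ` followed by the shift, at momentum `k`. -/
noncomputable def stepMatrix (φ k : ℝ) : Matrix (Fin 2) (Fin 2) ℂ :=
  !![Real.cos φ * Complex.exp (k * Complex.I), Real.sin φ * Complex.exp (k * Complex.I);
    Real.sin φ * Complex.exp (-(k * Complex.I)), -(Real.cos φ * Complex.exp (-(k * Complex.I)))]

/-- The Fourier transform `∑ x, e^{-ikx} ψ_t(x)` of the amplitude. -/
noncomputable def fourierAmplitude : ℕ → ℝ → (Fin 2 → ℂ)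
  | 0, _ => ![α, β]
  | t + 1, k => stepMatrix (coinAngle θ θ₁ τ t) k *ᵥ fourierAmplitude t k

/-- Reindexing the sum over `ℤ` by `x ± 1` turns the shift into the factors `exp (±ik)` in the rows
of `stepMatrix`. -/
theorem hasSum_fourierAmplitude (t : ℕ) (k : ℝ) (i : Fin 2) :
    HasSum (fun x : ℤ => Complex.exp (-(k * x * Complex.I)) * amplitude θ θ₁ α β τ t x i)
      (fourierAmplitude θ θ₁ α β τ t k i) := by
  induction t generalizing i with
  | zero =>
    have : fourierAmplitude θ θ₁ α β τ 0 k i =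
        Complex.exp (-(k * (0 : ℤ) * Complex.I)) * amplitude θ θ₁ α β τ 0 0 i := by
      simp [fourierAmplitude, amplitude]
    rw [this]
    refine hasSum_single 0 fun x hx => ?_
    simp [amplitude, hx]
  | succ t ih =>
    fin_cases i
    · have h := (Equiv.addRight (1 : ℤ)).hasSum_iff.2
        (((ih 0).mul_left (Real.cos (coinAngle θ θ₁ τ t) * Complex.exp (k * Complex.I))).add
        ((ih 1).mul_left (Real.sin (coinAngle θ θ₁ τ t) * Complex.exp (k * Complex.I))))
      convert! h using 1
      · funext x
        have e : Complex.exp (-(k * x * Complex.I)) =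
            Complex.exp (k * Complex.I) * Complex.exp (-(k * ((x + 1 : ℤ) : ℂ) * Complex.I)) := by
          rw [← Complex.exp_add]; congr 1; push_cast; ring
        simp only [Fin.zero_eta, amplitude_succ_zero, e, Function.comp_apply, Equiv.coe_addRight]
        ring
      · simp [fourierAmplitude, stepMatrix, Matrix.mulVec, dotProduct, Fin.sum_univ_two]
    · have h := (Equiv.subRight (1 : ℤ)).hasSum_iff.2
        (((ih 0).mul_left (Real.sin (coinAngle θ θ₁ τ t) * Complex.exp (-(k * Complex.I)))).sub
        ((ih 1).mul_left (Real.cos (coinAngle θ θ₁ τ t) * Complex.exp (-(k * Complex.I)))))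
      convert! h using 1
      · funext x
        have e : Complex.exp (-(k * x * Complex.I)) =
            Complex.exp (-(k * Complex.I)) *
              Complex.exp (-(k * ((x - 1 : ℤ) : ℂ) * Complex.I)) := by
          rw [← Complex.exp_add]; congr 1; push_cast; ring
        simp only [Fin.mk_one, amplitude_succ_one, e, Function.comp_apply, Equiv.subRight_apply]
        ring
      · simp [fourierAmplitude, stepMatrix, Matrix.mulVec, dotProduct, Fin.sum_univ_two]
        ring

theorem fourierAmplitude_eq_sum (t : ℕ) (k : ℝ) (i : Fin 2) :
    fourierAmplitude θ θ₁ α β τ t k i =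
      ∑ x ∈ Finset.Icc (-(t : ℤ)) t,
        Complex.exp (-(k * x * Complex.I)) * amplitude θ θ₁ α β τ t x i := by
  refine (hasSum_fourierAmplitude θ θ₁ α β τ t k i).unique (hasSum_sum_of_ne_finset_zero ?_)
  intro x hx
  rw [amplitude_eq_zero, mul_zero]
  rw [Finset.mem_Icc] at hx
  grind

theorem integral_exp_int_mul (n : ℤ) :
    ∫ k in (-Real.pi)..Real.pi, Complex.exp (n * k * Complex.I) =
      if n = 0 then (2 * Real.pi : ℂ) else 0 := by
  split_ifs with h
  · subst h
    simp
    ring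
  · have hn : (n : ℂ) * Complex.I ≠ 0 := by simp [h]
    have : ∀ k : ℝ, Complex.exp (n * k * Complex.I) = Complex.exp (n * Complex.I * k) := fun k => by
      congr 1; ring
    simp only [this]
    rw [integral_exp_mul_complex hn]
    have e : Complex.exp (n * Complex.I * (Real.pi : ℝ)) =
        Complex.exp (n * Complex.I * ((-Real.pi : ℝ) : ℂ)) := by
      rw [Complex.exp_eq_exp_iff_exists_int]
      exact ⟨n, by push_cast; ring⟩
    rw [e, sub_self, zero_div]

/-- Parseval's identity, where shifting the momentum by `ε` in one factor amounts to multiplying the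
amplitude at `x` by `exp (iεx)`. -/
theorem integral_star_fourierAmplitude_dotProduct (t : ℕ) (ε : ℝ) :
    ∫ k in (-Real.pi)..Real.pi,
      star (fourierAmplitude θ θ₁ α β τ t k) ⬝ᵥ fourierAmplitude θ θ₁ α β τ t (k - ε) =
      2 * Real.pi * ∑ x ∈ Finset.Icc (-(t : ℤ)) t,
        (prob θ θ₁ α β τ t x : ℂ) * Complex.exp (ε * x * Complex.I) := by
  have h : ∀ k : ℝ,
      star (fourierAmplitude θ θ₁ α β τ t k) ⬝ᵥ fourierAmplitude θ θ₁ α β τ t (k - ε) =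
      ∑ i, ∑ x ∈ Finset.Icc (-(t : ℤ)) t, ∑ y ∈ Finset.Icc (-(t : ℤ)) t,
        Complex.exp (ε * y * Complex.I) * (star (amplitude θ θ₁ α β τ t x i) *
          amplitude θ θ₁ α β τ t y i) * Complex.exp (((x - y : ℤ) : ℂ) * k * Complex.I) := by
    intro k
    simp only [dotProduct, Pi.star_apply, fourierAmplitude_eq_sum, star_sum,
      Finset.sum_mul_sum]
    refine Finset.sum_congr rfl fun i _ => Finset.sum_congr rfl fun x _ =>
      Finset.sum_congr rfl fun y _ => ?_
    have e1 : star (Complex.exp (-(k * x * Complex.I))) = Complex.exp (k * x * Complex.I) := by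
      rw [Complex.star_def, ← Complex.exp_conj]
      simp
    have e2 : Complex.exp (k * x * Complex.I) * Complex.exp (-(((k - ε : ℝ) : ℂ) * y * Complex.I)) =
        Complex.exp (ε * y * Complex.I) * Complex.exp (((x - y : ℤ) : ℂ) * k * Complex.I) := by
      rw [← Complex.exp_add, ← Complex.exp_add]
      congr 1
      push_cast
      ring
    rw [star_mul', e1]
    linear_combination (star (amplitude θ θ₁ α β τ t x i) * amplitude θ θ₁ α β τ t y i) * e2
  simp only [h]
  have hc : ∀ (a : ℂ) (n : ℤ), IntervalIntegrable
      (fun k : ℝ => a * Complex.exp (n * k * Complex.I)) volume (-Real.pi) Real.pi := fun a n =>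
    Continuous.intervalIntegrable (by fun_prop) _ _
  rw [intervalIntegral.integral_finsetSum fun i _ =>
    Continuous.intervalIntegrable (by fun_prop) _ _]
  simp only [prob, Complex.ofReal_sum, Finset.sum_mul, Finset.mul_sum]
  rw [Finset.sum_comm (s := Finset.Icc (-(t : ℤ)) t)]
  refine Finset.sum_congr rfl fun i _ => ?_
  rw [intervalIntegral.integral_finsetSum fun i _ =>
    Continuous.intervalIntegrable (by fun_prop) _ _]
  refine Finset.sum_congr rfl fun x hx => ?_
  rw [intervalIntegral.integral_finsetSum fun i _ => hc _ _]
  simp only [intervalIntegral.integral_const_mul, integral_exp_int_mul, sub_eq_zero, mul_ite,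
    mul_zero, Finset.sum_ite_eq, hx, if_true]
  rw [Complex.star_def, Complex.conj_mul']
  push_cast
  ring

theorem charFun_map_walkLaw (hαβ : ‖α‖ ^ 2 + ‖β‖ ^ 2 = 1) (t : ℕ) (r ξ : ℝ) :
    charFun ((walkLaw θ θ₁ α β τ t).map fun ω : ℤ => (ω : ℝ) / r) ξ =
      (2 * Real.pi : ℂ)⁻¹ * ∫ k in (-Real.pi)..Real.pi,
        star (fourierAmplitude θ θ₁ α β τ t k) ⬝ᵥ fourierAmplitude θ θ₁ α β τ t (k - ξ / r) := by
  have hP := isProbabilityMeasure_walkLaw θ θ₁ α β τ hαβ t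
  rw [integral_star_fourierAmplitude_dotProduct, ← mul_assoc,
    inv_mul_cancel₀ (by simp [Real.pi_ne_zero]), one_mul, charFun_apply_real,
    integral_map (by fun_prop) (by fun_prop), integral_countable]
  · rw [tsum_eq_sum (s := Finset.Icc (-(t : ℤ)) t)]
    · refine Finset.sum_congr rfl fun x _ => ?_
      rw [measureReal_def, walkLaw_singleton, ENNReal.toReal_ofReal (prob_nonneg θ θ₁ α β τ t x),
        Complex.real_smul]
      congr 2
      push_cast
      ring
    · intro x hx
      have : prob θ θ₁ α β τ t x = 0 := by
        refine Finset.sum_eq_zero fun i _ => ?_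
        rw [amplitude_eq_zero, norm_zero, zero_pow two_ne_zero]
        rw [Finset.mem_Icc] at hx
        grind
      simp [measureReal_def, walkLaw_singleton, this]
  · refine (integrable_const (1 : ℝ)).mono' (by fun_prop) (ae_of_all _ fun x => ?_)
    rw [← Complex.ofReal_mul, Complex.norm_exp_ofReal_mul_I]

end Walk

/-! ### Spectral decomposition of the step at fixed momentum -/

section Spectral

/-- The modulus `√(1 - cos² φ sin² k)` of the real part of the eigenvalues of `stepMatrix φ k`. -/
noncomputable def gap (φ k : ℝ) : ℝ := √(1 - (Real.cos φ * Real.sin k) ^ 2)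

/-- The argument of the eigenvalue of `stepMatrix φ k` with positive real part. -/
noncomputable def freq (φ k : ℝ) : ℝ := Real.arcsin (Real.cos φ * Real.sin k)

/-- The group velocity, the derivative of `freq φ`. -/
noncomputable def vel (φ k : ℝ) : ℝ := Real.cos φ * Real.cos k / gap φ k

/-- The Hermitian part of `stepMatrix φ k`. -/
noncomputable def hermPart (φ k : ℝ) : Matrix (Fin 2) (Fin 2) ℂ :=
  !![Real.cos φ * Real.cos k, Real.sin φ * Complex.exp (k * Complex.I);
    Real.sin φ * Complex.exp (-(k * Complex.I)), -(Real.cos φ * Real.cos k)]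

/-- The Hermitian involution that commutes with `stepMatrix φ k`. -/
noncomputable def involution (φ k : ℝ) : Matrix (Fin 2) (Fin 2) ℂ :=
  ((gap φ k)⁻¹ : ℂ) • hermPart φ k

/-- The sign of the real part of the eigenvalue on each of the two branches. -/
def branchSign (b : Bool) : ℝ := if b then 1 else -1

/-- The argument of the eigenvalue on each of the two branches. -/
noncomputable def branchFreq (φ : ℝ) (b : Bool) (k : ℝ) : ℝ :=
  if b then freq φ k else Real.pi - freq φ k

/-- The spectral projections of `stepMatrix φ k`. -/
noncomputable def branchProj (φ : ℝ) (b : Bool) (k : ℝ) : Matrix (Fin 2) (Fin 2) ℂ :=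
  (2⁻¹ : ℂ) • (1 + (branchSign b : ℂ) • involution φ k)

theorem branchSign_sq (b : Bool) : branchSign b ^ 2 = 1 := by cases b <;> simp [branchSign]

theorem one_sub_sq_eq (φ k : ℝ) : 1 - (Real.cos φ * Real.sin k) ^ 2 =
    Real.sin φ ^ 2 + Real.cos φ ^ 2 * Real.cos k ^ 2 := by
  have h1 := Real.sin_sq_add_cos_sq φ
  have h2 := Real.sin_sq_add_cos_sq k
  linear_combination Real.cos φ ^ 2 * (-h2) - h1

theorem gap_sq (φ k : ℝ) : gap φ k ^ 2 = Real.sin φ ^ 2 + Real.cos φ ^ 2 * Real.cos k ^ 2 := by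
  rw [gap, one_sub_sq_eq, Real.sq_sqrt (by positivity)]

theorem gap_pos {φ : ℝ} (hφ : Real.sin φ ≠ 0) (k : ℝ) : 0 < gap φ k := by
  rw [gap, one_sub_sq_eq]
  positivity

theorem continuous_gap (φ : ℝ) : Continuous (gap φ) := by
  unfold gap
  fun_prop

theorem continuous_freq (φ : ℝ) : Continuous (freq φ) := by
  unfold freq
  exact Real.continuous_arcsin.comp (by fun_prop)

theorem continuous_vel {φ : ℝ} (hφ : Real.sin φ ≠ 0) : Continuous (vel φ) := by
  unfold vel
  exact Continuous.div (by fun_prop) (continuous_gap φ) fun k => (gap_pos hφ k).ne'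

theorem abs_cos_mul_sin_lt_one {φ : ℝ} (hφ : Real.sin φ ≠ 0) (k : ℝ) :
    |Real.cos φ * Real.sin k| < 1 := by
  have h : 0 < 1 - (Real.cos φ * Real.sin k) ^ 2 := by
    rw [one_sub_sq_eq]
    positivity
  rw [← sq_lt_one_iff_abs_lt_one]
  linarith

theorem hasDerivAt_freq {φ : ℝ} (hφ : Real.sin φ ≠ 0) (k : ℝ) :
    HasDerivAt (freq φ) (vel φ k) k := by
  have h := abs_lt.1 (abs_cos_mul_sin_lt_one hφ k)
  have h1 : HasDerivAt (fun k => Real.cos φ * Real.sin k) (Real.cos φ * Real.cos k) k :=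
    (Real.hasDerivAt_sin k).const_mul _
  convert! (Real.hasDerivAt_arcsin h.1.ne' h.2.ne).comp k h1 using 1
  rw [vel, gap]
  ring

theorem hasDerivAt_branchFreq {φ : ℝ} (hφ : Real.sin φ ≠ 0) (b : Bool) (k : ℝ) :
    HasDerivAt (branchFreq φ b) (branchSign b * vel φ k) k := by
  cases b
  · simpa [branchFreq, branchSign] using! (hasDerivAt_freq hφ k).const_sub Real.pi
  · simpa [branchFreq, branchSign] using! hasDerivAt_freq hφ k

theorem continuous_branchFreq (φ : ℝ) (b : Bool) : Continuous (branchFreq φ b) := by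
  have := continuous_freq φ
  cases b
  · simpa [branchFreq] using! (continuous_const.sub this)
  · simpa [branchFreq] using! this

theorem exp_branchFreq (φ : ℝ) (b : Bool) (k : ℝ) :
    Complex.exp (branchFreq φ b k * Complex.I) =
      branchSign b * gap φ k + Real.cos φ * Real.sin k * Complex.I := by
  have h : |Real.cos φ * Real.sin k| ≤ 1 := by
    rw [abs_mul]
    exact mul_le_one₀ (Real.abs_cos_le_one _) (abs_nonneg _) (Real.abs_sin_le_one _)
  have hs : Real.sin (freq φ k) = Real.cos φ * Real.sin k :=
    Real.sin_arcsin (abs_le.1 h).1 (abs_le.1 h).2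
  have hc : Real.cos (freq φ k) = gap φ k := Real.cos_arcsin _
  rw [Complex.exp_mul_I, ← Complex.ofReal_cos, ← Complex.ofReal_sin]
  cases b <;> simp [branchFreq, branchSign, Real.sin_pi_sub, Real.cos_pi_sub, hs, hc]

theorem exp_mul_I_eq (k : ℝ) :
    Complex.exp (k * Complex.I) = Real.cos k + Real.sin k * Complex.I := by
  rw [Complex.exp_mul_I]; simp

theorem exp_neg_mul_I_eq (k : ℝ) :
    Complex.exp (-(k * Complex.I)) = Real.cos k - Real.sin k * Complex.I := by
  rw [← neg_mul, Complex.exp_mul_I]; simp; ring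

/-- The anti-Hermitian part is a scalar, so the spectral problem reduces to the traceless Hermitian
`hermPart`, whose square is a scalar. -/
theorem stepMatrix_eq (φ k : ℝ) : stepMatrix φ k =
    (Real.cos φ * Real.sin k * Complex.I) • (1 : Matrix (Fin 2) (Fin 2) ℂ) + hermPart φ k := by
  ext i j
  fin_cases i <;> fin_cases j <;>
    simp [stepMatrix, hermPart, exp_mul_I_eq, exp_neg_mul_I_eq] <;> ring

theorem hermPart_conjTranspose (φ k : ℝ) : (hermPart φ k)ᴴ = hermPart φ k := by
  ext i j
  fin_cases i <;> fin_cases j <;>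
    simp [hermPart, ← Complex.exp_conj, -Complex.ofReal_sin, -Complex.ofReal_cos]

/-- Traceless Hermitian 2×2 matrices form a Euclidean 3-space in which the anticommutator is twice
the inner product. The case of two different angles is what evaluates the coin `θ₁` between
projections of the coin `θ`. -/
theorem hermPart_mul_add (φ ψ k : ℝ) :
    hermPart φ k * hermPart ψ k + hermPart ψ k * hermPart φ k =
      ((2 * (Real.cos φ * Real.cos ψ * Real.cos k ^ 2 + Real.sin φ * Real.sin ψ) : ℝ) : ℂ) •
        (1 : Matrix (Fin 2) (Fin 2) ℂ) := by
  have e : Complex.exp (k * Complex.I) * Complex.exp (-(k * Complex.I)) = 1 := by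
    rw [← Complex.exp_add]; simp
  ext i j
  fin_cases i <;> fin_cases j <;>
    simp [hermPart, -Complex.ofReal_sin, -Complex.ofReal_cos]
  · linear_combination 2 * (Real.sin φ : ℂ) * Real.sin ψ * e
  · ring
  · ring
  · linear_combination 2 * (Real.sin φ : ℂ) * Real.sin ψ * e

theorem hermPart_mul_self (φ k : ℝ) :
    hermPart φ k * hermPart φ k = ((gap φ k : ℂ) ^ 2) • (1 : Matrix (Fin 2) (Fin 2) ℂ) := by
  have h := hermPart_mul_add φ φ k
  rw [← two_smul ℂ, Complex.ofReal_mul, mul_smul] at h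
  have h2 := smul_right_injective _ (two_ne_zero (α := ℂ)) h
  rw [h2, ← Complex.ofReal_pow, gap_sq]
  congr 2
  ring

theorem involution_mul_self {φ : ℝ} (hφ : Real.sin φ ≠ 0) (k : ℝ) :
    involution φ k * involution φ k = 1 := by
  have hg : (gap φ k : ℂ) ≠ 0 := by exact_mod_cast (gap_pos hφ k).ne'
  rw [involution, smul_mul_smul_comm, hermPart_mul_self, smul_smul]
  convert one_smul ℂ _
  field_simp

theorem gap_smul_involution {φ : ℝ} (hφ : Real.sin φ ≠ 0) (k : ℝ) :
    (gap φ k : ℂ) • involution φ k = hermPart φ k := by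
  have hg : (gap φ k : ℂ) ≠ 0 := by exact_mod_cast (gap_pos hφ k).ne'
  rw [involution, smul_smul, mul_inv_cancel₀ hg, one_smul]

theorem involution_conjTranspose (φ k : ℝ) : (involution φ k)ᴴ = involution φ k := by
  rw [involution, conjTranspose_smul, hermPart_conjTranspose]
  simp

theorem branchProj_conjTranspose (φ : ℝ) (b : Bool) (k : ℝ) :
    (branchProj φ b k)ᴴ = branchProj φ b k := by
  simp [branchProj, conjTranspose_smul, conjTranspose_add, involution_conjTranspose]

theorem branchProj_mul_self {φ : ℝ} (hφ : Real.sin φ ≠ 0) (b : Bool) (k : ℝ) :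
    branchProj φ b k * branchProj φ b k = branchProj φ b k := by
  have h := involution_mul_self hφ k
  have hs : (branchSign b : ℂ) * branchSign b = 1 := by
    rw [← sq]; exact_mod_cast branchSign_sq b
  simp only [branchProj, smul_mul_smul_comm, mul_add, add_mul, one_mul, mul_one, h, hs]
  module

theorem branchProj_add (φ : ℝ) (b : Bool) (k : ℝ) :
    branchProj φ b k + branchProj φ (!b) k = 1 := by
  have hs : (branchSign (!b) : ℂ) = - branchSign b := by cases b <;> simp [branchSign]
  simp only [branchProj, hs]
  module

theorem branchProj_mul_not {φ : ℝ} (hφ : Real.sin φ ≠ 0) (b : Bool) (k : ℝ) :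
    branchProj φ b k * branchProj φ (!b) k = 0 := by
  rw [eq_sub_iff_add_eq'.2 (branchProj_add φ b k), mul_sub, mul_one, branchProj_mul_self hφ,
    sub_self]

theorem stepMatrix_mul_branchProj {φ : ℝ} (hφ : Real.sin φ ≠ 0) (b : Bool) (k : ℝ) :
    stepMatrix φ k * branchProj φ b k =
      Complex.exp (branchFreq φ b k * Complex.I) • branchProj φ b k := by
  have h := involution_mul_self hφ k
  have hs : (branchSign b : ℂ) * branchSign b = 1 := by
    rw [← sq]; exact_mod_cast branchSign_sq b
  have hs' : (branchSign b : ℂ) ^ 2 = 1 := by rw [sq, hs]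
  rw [stepMatrix_eq, exp_branchFreq, branchProj, ← gap_smul_involution hφ]
  simp only [add_mul, mul_add, smul_mul_assoc, mul_smul_comm, one_mul, mul_one, h]
  match_scalars
  · ring
  · linear_combination (-(2 : ℂ)⁻¹ * gap φ k) * hs'

theorem continuous_hermPart (φ : ℝ) : Continuous (hermPart φ) := by
  refine continuous_matrix fun i j => ?_
  fin_cases i <;> fin_cases j <;> simp [hermPart] <;> fun_prop

theorem continuous_stepMatrix (φ : ℝ) : Continuous (stepMatrix φ) := by
  refine continuous_matrix fun i j => ?_
  fin_cases i <;> fin_cases j <;> simp [stepMatrix] <;> fun_prop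

theorem continuous_branchProj {φ : ℝ} (hφ : Real.sin φ ≠ 0) (b : Bool) :
    Continuous (branchProj φ b) := by
  have h1 : Continuous fun k => ((gap φ k)⁻¹ : ℂ) :=
    (Complex.continuous_ofReal.comp (continuous_gap φ)).inv₀ fun k =>
      Complex.ofReal_ne_zero.2 (gap_pos hφ k).ne'
  have h2 := continuous_hermPart φ
  unfold branchProj involution
  fun_prop

theorem stepMatrix_conjTranspose_mul_self (φ k : ℝ) :
    (stepMatrix φ k)ᴴ * stepMatrix φ k = 1 := by
  have e : Complex.exp (k * Complex.I) * Complex.exp (-(k * Complex.I)) = 1 := by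
    rw [← Complex.exp_add]; simp
  have h : (Real.sin φ : ℂ) ^ 2 + (Real.cos φ : ℂ) ^ 2 = 1 := by
    exact_mod_cast Real.sin_sq_add_cos_sq φ
  ext i j
  fin_cases i <;> fin_cases j <;>
    simp [stepMatrix, Matrix.mul_apply, Fin.sum_univ_two, -Complex.ofReal_sin,
      -Complex.ofReal_cos, ← Complex.exp_conj]
  · linear_combination ((Real.sin φ : ℂ) ^ 2 + (Real.cos φ : ℂ) ^ 2) * e + h
  · ring
  · ring
  · linear_combination ((Real.sin φ : ℂ) ^ 2 + (Real.cos φ : ℂ) ^ 2) * e + h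

/-! ### Transitions between the branches at the exceptional step -/

/-- The probability that the coin of angle `ψ` moves a state from one branch to the other. -/
noncomputable def switchProb (φ ψ k : ℝ) : ℝ :=
  ((Real.cos ψ * Real.sin φ - Real.sin ψ * Real.cos φ) * Real.cos k / gap φ k) ^ 2

/-- Lagrange's identity for the plane vectors `(sin φ, cos φ cos k)` and `(sin ψ, cos ψ cos k)`:
their determinant gives `switchProb`, their inner product the last term. -/
theorem one_sub_switchProb {φ : ℝ} (hφ : Real.sin φ ≠ 0) (ψ k : ℝ) :
    1 - switchProb φ ψ k = (Real.cos ψ * Real.sin k) ^ 2 +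
      ((Real.cos φ * Real.cos ψ * Real.cos k ^ 2 + Real.sin φ * Real.sin ψ) / gap φ k) ^ 2 := by
  have hg := (gap_pos hφ k).ne'
  have h2 := gap_sq φ k
  have h3 := one_sub_sq_eq ψ k
  rw [switchProb, div_pow, div_pow]
  field_simp
  linear_combination gap φ k ^ 2 * h3 +
    (Real.sin ψ ^ 2 + Real.cos ψ ^ 2 * Real.cos k ^ 2) * h2

/-- The projection has rank one, so the compression is a scalar. The anticommutator finds it without
eigenvectors: moving the projection past `hermPart ψ k` leaves a scalar and the complementary
projection, which the projection on the right kills. -/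
theorem branchProj_mul_stepMatrix_mul {φ : ℝ} (hφ : Real.sin φ ≠ 0) (ψ : ℝ) (b : Bool) (k : ℝ) :
    branchProj φ b k * (stepMatrix ψ k * branchProj φ b k) =
      (((branchSign b * ((Real.cos φ * Real.cos ψ * Real.cos k ^ 2 + Real.sin φ * Real.sin ψ) /
        gap φ k) : ℝ) : ℂ) + ((Real.cos ψ * Real.sin k : ℝ) : ℂ) * Complex.I) •
        branchProj φ b k := by
  have hg : (gap φ k : ℂ) ≠ 0 := by exact_mod_cast (gap_pos hφ k).ne'
  have h := involution_mul_self hφ k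
  have hs : (branchSign b : ℂ) ^ 2 = 1 := by exact_mod_cast branchSign_sq b
  set κ : ℝ := (Real.cos φ * Real.cos ψ * Real.cos k ^ 2 + Real.sin φ * Real.sin ψ) / gap φ k
    with hκ
  have hanti : involution φ k * hermPart ψ k =
      (2 * κ : ℂ) • (1 : Matrix (Fin 2) (Fin 2) ℂ) - hermPart ψ k * involution φ k := by
    rw [eq_sub_iff_add_eq, involution, smul_mul_assoc, mul_smul_comm, ← smul_add,
      hermPart_mul_add, smul_smul, hκ]
    congr 1
    push_cast
    field_simp
  have hP : branchProj φ b k * hermPart ψ k =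
      ((branchSign b * κ : ℝ) : ℂ) • 1 + hermPart ψ k * (1 - branchProj φ b k) := by
    simp only [branchProj, smul_mul_assoc, add_mul, one_mul, hanti, mul_sub, mul_one,
      mul_smul_comm, mul_add]
    push_cast
    module
  have h0 : (1 - branchProj φ b k) * branchProj φ b k = 0 := by
    rw [sub_mul, one_mul, branchProj_mul_self hφ, sub_self]
  rw [stepMatrix_eq, ← mul_assoc, mul_add, hP, mul_smul_comm, mul_one, add_mul, add_mul,
    mul_assoc (hermPart ψ k), h0, mul_zero, smul_mul_assoc, smul_mul_assoc, branchProj_mul_self hφ,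
    one_mul, add_zero, ← add_smul]
  congr 1
  push_cast
  ring

theorem star_mulVec_dotProduct_mulVec (A B : Matrix (Fin 2) (Fin 2) ℂ) (v w : Fin 2 → ℂ) :
    star (A *ᵥ v) ⬝ᵥ (B *ᵥ w) = star v ⬝ᵥ ((Aᴴ * B) *ᵥ w) := by
  rw [star_mulVec, ← dotProduct_mulVec, mulVec_mulVec]

/-- The component on branch `j` after the coin of angle `ψ` is applied to the component of `v` on
branch `l`. -/
noncomputable def branchAmplitude (φ ψ : ℝ) (v : Fin 2 → ℂ) (j l : Bool) (k : ℝ) : Fin 2 → ℂ :=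
  (branchProj φ j k * (stepMatrix ψ k * branchProj φ l k)) *ᵥ v

theorem continuous_branchAmplitude {φ : ℝ} (hφ : Real.sin φ ≠ 0) (ψ : ℝ) (v : Fin 2 → ℂ)
    (j l : Bool) : Continuous (branchAmplitude φ ψ v j l) := by
  have h1 := continuous_branchProj hφ j
  have h2 := continuous_branchProj hφ l
  have h3 := continuous_stepMatrix ψ
  unfold branchAmplitude
  fun_prop

/-- Both amplitudes are at the same momentum `k`. In the characteristic function the momenta differ
by `ξ / t`, so this orthogonality acts only in the limit. -/
theorem branchAmplitude_orthogonal {φ : ℝ} (hφ : Real.sin φ ≠ 0) (ψ : ℝ) (v : Fin 2 → ℂ)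
    {j j' : Bool} (hj : j ≠ j') (l l' : Bool) (k : ℝ) :
    star (branchAmplitude φ ψ v j l k) ⬝ᵥ branchAmplitude φ ψ v j' l' k = 0 := by
  obtain rfl : j' = !j := by cases j <;> cases j' <;> simp_all
  rw [branchAmplitude, branchAmplitude, star_mulVec_dotProduct_mulVec, conjTranspose_mul,
    branchProj_conjTranspose, mul_assoc, ← mul_assoc (branchProj φ j k), branchProj_mul_not hφ]
  simp

/-- The expectation of `involution φ k` in the state `v`. -/
noncomputable def branchBias (φ : ℝ) (v : Fin 2 → ℂ) (k : ℝ) : ℂ :=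
  star v ⬝ᵥ (involution φ k *ᵥ v)

theorem dotProduct_branchProj (φ : ℝ) (v : Fin 2 → ℂ) (hv : star v ⬝ᵥ v = 1) (b : Bool) (k : ℝ) :
    star v ⬝ᵥ (branchProj φ b k *ᵥ v) = (1 + branchSign b * branchBias φ v k) / 2 := by
  rw [branchProj, smul_mulVec, add_mulVec, one_mulVec, smul_mulVec, dotProduct_smul,
    dotProduct_add, dotProduct_smul, hv, branchBias]
  simp only [smul_eq_mul]
  ring

theorem branchAmplitude_self {φ : ℝ} (hφ : Real.sin φ ≠ 0) (ψ : ℝ) (v : Fin 2 → ℂ)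
    (hv : star v ⬝ᵥ v = 1) (b : Bool) (k : ℝ) :
    star (branchAmplitude φ ψ v b b k) ⬝ᵥ branchAmplitude φ ψ v b b k =
      (1 - switchProb φ ψ k : ℝ) * ((1 + branchSign b * branchBias φ v k) / 2) := by
  rw [← dotProduct_branchProj φ v hv, branchAmplitude, branchProj_mul_stepMatrix_mul hφ,
    star_mulVec_dotProduct_mulVec, conjTranspose_smul, branchProj_conjTranspose,
    smul_mul_smul_comm, branchProj_mul_self hφ, smul_mulVec, dotProduct_smul, smul_eq_mul,
    Complex.star_def, Complex.conj_mul', ← Complex.ofReal_pow,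
    ← Complex.normSq_eq_norm_sq, Complex.normSq_add_mul_I,
    one_sub_switchProb hφ, mul_pow (branchSign b), branchSign_sq, one_mul,
    add_comm ((Real.cos ψ * Real.sin k) ^ 2)]

/-- By unitarity of the coin step the squared norms on the two target branches add up to that of the
projected initial state, so this is the complement of `branchAmplitude_self`. -/
theorem branchAmplitude_not {φ : ℝ} (hφ : Real.sin φ ≠ 0) (ψ : ℝ) (v : Fin 2 → ℂ)
    (hv : star v ⬝ᵥ v = 1) (b : Bool) (k : ℝ) :
    star (branchAmplitude φ ψ v (!b) b k) ⬝ᵥ branchAmplitude φ ψ v (!b) b k =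
      (switchProb φ ψ k : ℝ) * ((1 + branchSign b * branchBias φ v k) / 2) := by
  have h1 := branchAmplitude_self hφ ψ v hv b k
  have h2 : star (branchAmplitude φ ψ v b b k) ⬝ᵥ branchAmplitude φ ψ v b b k +
      star (branchAmplitude φ ψ v (!b) b k) ⬝ᵥ branchAmplitude φ ψ v (!b) b k =
      (1 + branchSign b * branchBias φ v k) / 2 := by
    rw [← dotProduct_branchProj φ v hv]
    simp only [branchAmplitude, star_mulVec_dotProduct_mulVec, ← dotProduct_add, ← add_mulVec]
    congr 2
    have hp : ∀ c X, (branchProj φ c k * X)ᴴ * (branchProj φ c k * X) =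
        Xᴴ * (branchProj φ c k * X) := fun c X => by
      rw [conjTranspose_mul, branchProj_conjTranspose, mul_assoc, ← mul_assoc (branchProj φ c k),
        branchProj_mul_self hφ]
    rw [hp, hp, ← mul_add, ← add_mul, branchProj_add, one_mul, conjTranspose_mul,
      branchProj_conjTranspose, mul_assoc, ← mul_assoc (stepMatrix ψ k)ᴴ,
      stepMatrix_conjTranspose_mul_self, one_mul, branchProj_mul_self hφ]
  rw [h1] at h2
  push_cast at h2 ⊢
  linear_combination h2

theorem fourierAmplitude_eq_branches {θ : ℝ} (hθ : Real.sin θ ≠ 0) (θ₁ : ℝ) (α β : ℂ)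
    (τ m : ℕ) (k : ℝ) :
    fourierAmplitude θ θ₁ α β τ (τ + 1 + m) k =
      ∑ j, ∑ l, Complex.exp ((m * branchFreq θ j k + τ * branchFreq θ l k : ℝ) * Complex.I) •
        branchAmplitude θ θ₁ ![α, β] j l k := by
  -- Before the exceptional step, which leads from time `τ` to `τ + 1`, each spectral component only
  -- gains its own phase.
  have h1 : ∀ t ≤ τ, fourierAmplitude θ θ₁ α β τ t k =
      ∑ l, Complex.exp ((t * branchFreq θ l k : ℝ) * Complex.I) •
        (branchProj θ l k *ᵥ ![α, β]) := by
    intro t ht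
    induction t with
    | zero =>
      have h := branchProj_add θ true k
      simp only [Bool.not_true] at h
      simp only [fourierAmplitude, Fintype.sum_bool, Nat.cast_zero, zero_mul, Complex.ofReal_zero,
        Complex.exp_zero, one_smul, ← add_mulVec, h, one_mulVec]
    | succ t ih =>
      rw [fourierAmplitude, ih (by omega), coinAngle, if_neg (by omega), mulVec_sum]
      refine Finset.sum_congr rfl fun l _ => ?_
      rw [mulVec_smul, mulVec_mulVec, stepMatrix_mul_branchProj hθ, smul_mulVec, smul_smul,
        ← Complex.exp_add]
      congr 2
      push_cast
      ring
  induction m with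
  | zero =>
    rw [add_zero, fourierAmplitude, h1 τ le_rfl, coinAngle, if_pos rfl, mulVec_sum,
      Finset.sum_comm]
    refine Finset.sum_congr rfl fun l _ => ?_
    have h := branchProj_add θ true k
    simp only [Bool.not_true] at h
    simp only [Fintype.sum_bool, Nat.cast_zero, zero_mul, zero_add, ← smul_add, branchAmplitude,
      ← add_mulVec, ← add_mul, h, one_mul, mulVec_smul, mulVec_mulVec]
  | succ m ih =>
    rw [← add_assoc, fourierAmplitude, ih, coinAngle, if_neg (by omega), mulVec_sum]
    refine Finset.sum_congr rfl fun j _ => ?_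
    rw [mulVec_sum]
    refine Finset.sum_congr rfl fun l _ => ?_
    rw [mulVec_smul, branchAmplitude, mulVec_mulVec, ← mul_assoc (stepMatrix θ k),
      stepMatrix_mul_branchProj hθ, smul_mul_assoc, smul_mulVec, smul_smul, ← Complex.exp_add]
    congr 2
    push_cast
    ring

end Spectral

/-! ### Oscillatory integrals and the limit of the overlaps -/

section Asymptotics

theorem tendsto_integral_exp_mul_cocompact (G : ℝ → ℂ) :
    Tendsto (fun r : ℝ => ∫ y : ℝ, Complex.exp ((r * y : ℝ) * Complex.I) * G y)
      (cocompact ℝ) (𝓝 0) := by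
  have h := Real.tendsto_integral_exp_smul_cocompact G
  -- The scaling converts Mathlib's character `exp (-2πi r y)` into `exp (i r y)`.
  have hm : Tendsto (fun r : ℝ => (-(2 * Real.pi)⁻¹) * r) (cocompact ℝ) (cocompact ℝ) :=
    (Homeomorph.mulLeft₀ (-(2 * Real.pi)⁻¹)
      (by simp [Real.pi_ne_zero])).isClosedEmbedding.tendsto_cocompact
  refine (h.comp hm).congr fun r => ?_
  simp only [Function.comp_apply, Real.fourierChar_apply', Circle.smul_def, Circle.coe_exp,
    smul_eq_mul]
  refine integral_congr_ae (ae_of_all _ fun y => ?_)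
  simp only
  congr 3
  have : Real.pi ≠ 0 := Real.pi_ne_zero
  field_simp

theorem injOn_freq {φ : ℝ} (hc : Real.cos φ ≠ 0) {s : Set ℝ} (hs : Set.InjOn Real.sin s) :
    Set.InjOn (freq φ) s := by
  have h : ∀ k, |Real.cos φ * Real.sin k| ≤ 1 := fun k => by
    rw [abs_mul]
    exact mul_le_one₀ (Real.abs_cos_le_one _) (abs_nonneg _) (Real.abs_sin_le_one _)
  intro x hx y hy hxy
  have := Real.injOn_arcsin (abs_le.1 (h x)) (abs_le.1 (h y)) hxy
  exact hs hx hy (mul_left_cancel₀ hc this)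

/-- On a set where `freq` is injective with nonzero derivative, it can serve as the variable of
integration, and the Riemann–Lebesgue lemma applies. No integrability of `g` is needed: both this
lemma and the change of variables hold with the convention that a non-integrable function has
integral `0`. -/
theorem tendsto_setIntegral_exp_freq {φ : ℝ} (hs : Real.sin φ ≠ 0) (hc : Real.cos φ ≠ 0)
    {s : Set ℝ} (hsm : MeasurableSet s) (hinj : Set.InjOn Real.sin s)
    (hcos : ∀ k ∈ s, Real.cos k ≠ 0) (g : ℝ → ℂ) :
    Tendsto (fun r : ℝ => ∫ k in s, Complex.exp ((r * freq φ k : ℝ) * Complex.I) * g k)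
      (cocompact ℝ) (𝓝 0) := by
  have hinj' := injOn_freq hc hinj
  set ι := Function.invFunOn (freq φ) s
  have hι : ∀ k ∈ s, ι (freq φ k) = k := fun k hk => hinj'.leftInvOn_invFunOn hk
  set G : ℝ → ℂ := (freq φ '' s).indicator fun y => ((|vel φ (ι y)| : ℝ) : ℂ)⁻¹ * g (ι y) with hG
  have hd : ∀ k ∈ s, HasDerivWithinAt (freq φ) (vel φ k) s k := fun k _ =>
    (hasDerivAt_freq hs k).hasDerivWithinAt
  have hms : MeasurableSet (freq φ '' s) :=
    hsm.image_of_continuousOn_injOn (continuous_freq φ).continuousOn hinj'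
  refine (tendsto_integral_exp_mul_cocompact G).congr fun r => ?_
  have h1 : ∀ y, Complex.exp ((r * y : ℝ) * Complex.I) * G y = (freq φ '' s).indicator
      (fun y => Complex.exp ((r * y : ℝ) * Complex.I) *
        (((|vel φ (ι y)| : ℝ) : ℂ)⁻¹ * g (ι y))) y := fun y => by
    by_cases hy : y ∈ freq φ '' s <;> simp [hG, hy]
  simp only [h1]
  rw [integral_indicator hms, integral_image_eq_integral_abs_deriv_smul hsm hd hinj']
  refine setIntegral_congr_fun hsm fun k hk => ?_
  have hv : ((|vel φ k| : ℝ) : ℂ) ≠ 0 := by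
    have : vel φ k ≠ 0 := div_ne_zero (mul_ne_zero hc (hcos k hk)) (gap_pos hs k).ne'
    exact_mod_cast abs_ne_zero.2 this
  simp only [hι k hk, Complex.real_smul]
  field_simp

theorem tendsto_integral_exp_freq {φ : ℝ} (hs : Real.sin φ ≠ 0) (hc : Real.cos φ ≠ 0)
    {g : ℝ → ℂ} (hg : Continuous g) :
    Tendsto (fun r : ℝ => ∫ k in (-Real.pi)..Real.pi,
      Complex.exp ((r * freq φ k : ℝ) * Complex.I) * g k) (cocompact ℝ) (𝓝 0) := by
  have hpi := Real.pi_pos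
  -- The period is cut at `±π/2`, the critical points of `freq`; on each of the three pieces `sin`
  -- is injective.
  have h1 := tendsto_setIntegral_exp_freq hs hc (s := Set.Ioo (-Real.pi) (-(Real.pi / 2)))
    measurableSet_Ioo (fun x hx y hy hxy => by
      have h := Real.injOn_sin (x₁ := x + Real.pi) (x₂ := y + Real.pi)
        ⟨by linarith [hx.1], by linarith [hx.2]⟩ ⟨by linarith [hy.1], by linarith [hy.2]⟩
        (by rw [Real.sin_add_pi, Real.sin_add_pi, hxy])
      linarith) (fun k hk => by
      have : 0 < Real.cos (k + Real.pi) :=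
        Real.cos_pos_of_mem_Ioo ⟨by linarith [hk.1], by linarith [hk.2]⟩
      rw [Real.cos_add_pi] at this
      linarith) g
  have h2 := tendsto_setIntegral_exp_freq hs hc (s := Set.Ioo (-(Real.pi / 2)) (Real.pi / 2))
    measurableSet_Ioo (Real.injOn_sin.mono Set.Ioo_subset_Icc_self)
    (fun k hk => (Real.cos_pos_of_mem_Ioo hk).ne') g
  have h3 := tendsto_setIntegral_exp_freq hs hc (s := Set.Ioo (Real.pi / 2) Real.pi)
    measurableSet_Ioo (fun x hx y hy hxy => by
      have h := Real.injOn_sin (x₁ := Real.pi - x) (x₂ := Real.pi - y)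
        ⟨by linarith [hx.2], by linarith [hx.1]⟩ ⟨by linarith [hy.2], by linarith [hy.1]⟩
        (by rw [Real.sin_pi_sub, Real.sin_pi_sub, hxy])
      linarith) (fun k hk => by
      have : 0 < Real.cos (Real.pi - k) :=
        Real.cos_pos_of_mem_Ioo ⟨by linarith [hk.2], by linarith [hk.1]⟩
      rw [Real.cos_pi_sub] at this
      linarith) g
  have h := (h1.add h2).add h3
  rw [add_zero, add_zero] at h
  refine h.congr fun r => ?_
  have hf := continuous_freq φ
  have hi : ∀ a b : ℝ, IntervalIntegrable
      (fun k => Complex.exp ((r * freq φ k : ℝ) * Complex.I) * g k) volume a b := fun a b =>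
    Continuous.intervalIntegrable (by fun_prop) a b
  rw [← intervalIntegral.integral_add_adjacent_intervals (hi _ (Real.pi / 2)) (hi _ _),
    ← intervalIntegral.integral_add_adjacent_intervals (hi _ (-(Real.pi / 2))) (hi _ _),
    intervalIntegral.integral_of_le (by linarith), intervalIntegral.integral_of_le (by linarith),
    intervalIntegral.integral_of_le (by linarith), integral_Ioc_eq_integral_Ioo,
    integral_Ioc_eq_integral_Ioo, integral_Ioc_eq_integral_Ioo]

/-- In an oscillatory integral, a phase perturbation that converges pointwise may be replaced by
its limit, and a vanishing shift of the amplitude may be dropped. -/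
theorem tendsto_integral_exp_phase_sub {A δ : ℕ → ℝ → ℝ} {δ' : ℝ → ℝ} {C : ℝ → ℝ → ℂ} {ε : ℕ → ℝ}
    {R : ℝ} (a b : ℝ) (hA : ∀ n, Continuous (A n)) (hδ : ∀ n, Continuous (δ n))
    (hδ' : Continuous δ') (hC : Continuous (Function.uncurry C)) (hε : Tendsto ε atTop (𝓝 0))
    (hR : ∀ n, |ε n| ≤ R) (hlim : ∀ k, Tendsto (fun n => δ n k) atTop (𝓝 (δ' k))) :
    Tendsto (fun n => (∫ k in a..b, Complex.exp ((A n k + δ n k : ℝ) * Complex.I) * C k (k - ε n)) -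
      ∫ k in a..b, Complex.exp ((A n k : ℝ) * Complex.I) *
        (Complex.exp ((δ' k : ℝ) * Complex.I) * C k k)) atTop (𝓝 0) := by
  have hC1 : ∀ n, Continuous fun k => C k (k - ε n) := fun n =>
    hC.comp (f := fun k => (k, k - ε n)) (by fun_prop)
  have hC2 : Continuous fun k => C k k := hC.comp (f := fun k => (k, k)) (by fun_prop)
  -- The box is enlarged by `R` so that it contains every shifted argument `k - ε n`; the bound on
  -- it dominates the integrands.
  obtain ⟨M, hM⟩ := ((isCompact_uIcc (a := a) (b := b)).prod
    (isCompact_Icc (a := min a b - R) (b := max a b + R))).exists_bound_of_continuousOn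
    hC.continuousOn
  have key : Tendsto (fun n => ∫ k in a..b,
      (Complex.exp ((A n k + δ n k : ℝ) * Complex.I) * C k (k - ε n) -
        Complex.exp ((A n k : ℝ) * Complex.I) * (Complex.exp ((δ' k : ℝ) * Complex.I) * C k k)))
      atTop (𝓝 (∫ _ in a..b, (0 : ℂ))) := by
    refine intervalIntegral.tendsto_integral_filter_of_dominated_convergence (fun _ => M + M)
      (Eventually.of_forall fun n => ?_) (Eventually.of_forall fun n => ae_of_all _ fun k hk => ?_)
      (by simp) (ae_of_all _ fun k _ => ?_)
    · have := hA n
      have := hδ n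
      have := hC1 n
      exact Continuous.aestronglyMeasurable (by fun_prop)
    · have hk' := Set.uIoc_subset_uIcc hk
      have hk2 : min a b ≤ k ∧ k ≤ max a b := hk'
      have hR' := abs_le.1 (hR n)
      have hR0 := (abs_nonneg _).trans (hR n)
      refine (norm_sub_le _ _).trans (add_le_add ?_ ?_)
      · rw [norm_mul, Complex.norm_exp_ofReal_mul_I, one_mul]
        exact hM (k, k - ε n) ⟨hk', by constructor <;> linarith⟩
      · rw [norm_mul, norm_mul, Complex.norm_exp_ofReal_mul_I, Complex.norm_exp_ofReal_mul_I,
          one_mul, one_mul]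
        exact hM (k, k) ⟨hk', by constructor <;> linarith⟩
    -- The phase `A n k` need not converge, but it is a common factor of modulus one and drops out
    -- of the norm of the difference.
    · have h1 : Tendsto (fun n => Complex.exp ((δ n k : ℝ) * Complex.I) * C k (k - ε n) -
          Complex.exp ((δ' k : ℝ) * Complex.I) * C k k) atTop (𝓝 0) := by
        have e1 : Tendsto (fun n => Complex.exp ((δ n k : ℝ) * Complex.I)) atTop
            (𝓝 (Complex.exp ((δ' k : ℝ) * Complex.I))) :=
          ((by fun_prop : Continuous fun y : ℝ => Complex.exp ((y : ℂ) * Complex.I)).tendsto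
            (δ' k)).comp (hlim k)
        have e2 : Tendsto (fun n => C k (k - ε n)) atTop (𝓝 (C k k)) := by
          have e3 : Tendsto (fun n => (k, k - ε n)) atTop (𝓝 (k, k)) :=
            tendsto_const_nhds.prodMk_nhds (by simpa using tendsto_const_nhds.sub hε)
          exact (hC.tendsto (k, k)).comp e3
        simpa using (e1.mul e2).sub (tendsto_const_nhds
          (x := Complex.exp ((δ' k : ℝ) * Complex.I) * C k k))
      rw [tendsto_zero_iff_norm_tendsto_zero] at h1 ⊢
      refine h1.congr fun n => ?_
      rw [Complex.ofReal_add, add_mul, Complex.exp_add, mul_assoc, ← mul_sub, norm_mul,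
        Complex.norm_exp_ofReal_mul_I, one_mul]
  rw [intervalIntegral.integral_zero] at key
  refine key.congr fun n => ?_
  have := hA n
  have := hδ n
  have := hC1 n
  exact intervalIntegral.integral_sub (Continuous.intervalIntegrable (by fun_prop) _ _)
    (Continuous.intervalIntegrable (by fun_prop) _ _)

theorem tendsto_mul_sub_of_hasDerivAt {b : ℝ → ℝ} {b' k a : ℝ} (hb : HasDerivAt b b' k)
    {n ε : ℕ → ℝ} (hε : Tendsto ε atTop (𝓝 0))
    (hn : Tendsto (fun i => n i * ε i) atTop (𝓝 a)) :
    Tendsto (fun i => n i * (b (k - ε i) - b k)) atTop (𝓝 (-(a * b'))) := by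
  have h := hb.hasFDerivAt.hasFDerivWithinAt (s := Set.univ) |>.lim (c := n)
    (d := fun i => -ε i) (v := -a) (by simpa using hε.neg) (by simp) (by simpa using hn.neg)
  simpa [sub_eq_add_neg] using h

variable {θ : ℝ} (θ₁ : ℝ) (v : Fin 2 → ℂ)

theorem continuous_uncurry_dotProduct_branchAmplitude (hs : Real.sin θ ≠ 0) (j l j' l' : Bool) :
    Continuous (Function.uncurry fun k k' =>
      star (branchAmplitude θ θ₁ v j l k) ⬝ᵥ branchAmplitude θ θ₁ v j' l' k') := by
  have h1 := continuous_branchAmplitude hs θ₁ v j l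
  have h2 := continuous_branchAmplitude hs θ₁ v j' l'
  unfold Function.uncurry
  simp only
  fun_prop

theorem tendsto_div_two_mul_add (e : ℕ) (ξ : ℝ) :
    Tendsto (fun τ : ℕ => ξ / ((2 * τ + (e + 1) : ℕ) : ℝ)) atTop (𝓝 0) := by
  refine tendsto_const_nhds.div_atTop (tendsto_natCast_atTop_atTop.comp ?_)
  exact tendsto_atTop_mono (fun τ => (by omega : τ ≤ 2 * τ + (e + 1))) tendsto_id

theorem tendsto_mul_div_two_mul_add (e d : ℕ) (ξ : ℝ) :
    Tendsto (fun τ : ℕ => ((τ + d : ℕ) : ℝ) * (ξ / ((2 * τ + (e + 1) : ℕ) : ℝ))) atTop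
      (𝓝 (ξ / 2)) := by
  -- The exact error is used: `(τ + d) / (2τ + e + 1) = 1/2 + (d - (e + 1)/2) / (2τ + e + 1)`.
  have h := (tendsto_div_two_mul_add e ((d - (e + 1) / 2) * ξ)).const_add (ξ / 2)
  rw [add_zero] at h
  refine h.congr fun τ => ?_
  have : ((2 * τ + (e + 1) : ℕ) : ℝ) ≠ 0 := by positivity
  field_simp
  push_cast
  ring

theorem tendsto_integral_branch_term (hs : Real.sin θ ≠ 0) (hc : Real.cos θ ≠ 0) (e : ℕ) (ξ : ℝ)
    (j l j' l' : Bool) :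
    Tendsto (fun τ : ℕ => ∫ k in (-Real.pi)..Real.pi,
      Complex.exp ((((τ + e : ℕ) : ℝ) *
        (branchFreq θ j' (k - ξ / ((2 * τ + (e + 1) : ℕ) : ℝ)) - branchFreq θ j k) +
        (τ : ℝ) * (branchFreq θ l' (k - ξ / ((2 * τ + (e + 1) : ℕ) : ℝ)) - branchFreq θ l k) : ℝ) *
          Complex.I) *
        (star (branchAmplitude θ θ₁ v j l k) ⬝ᵥ
          branchAmplitude θ θ₁ v j' l' (k - ξ / ((2 * τ + (e + 1) : ℕ) : ℝ)))) atTop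
      (𝓝 (if j = j' ∧ l = l' then ∫ k in (-Real.pi)..Real.pi,
        Complex.exp ((-(ξ / 2 * (branchSign j + branchSign l) * vel θ k) : ℝ) * Complex.I) *
          (star (branchAmplitude θ θ₁ v j l k) ⬝ᵥ branchAmplitude θ θ₁ v j l k) else 0)) := by
  set ε : ℕ → ℝ := fun τ => ξ / ((2 * τ + (e + 1) : ℕ) : ℝ) with hεdef
  have hε : Tendsto ε atTop (𝓝 0) := tendsto_div_two_mul_add e ξ
  have hR : ∀ n, |ε n| ≤ |ξ| := fun n => by
    rw [hεdef, abs_div, Nat.abs_cast]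
    exact div_le_self (abs_nonneg _) (by exact_mod_cast (by omega))
  have hv := continuous_vel hs
  have hcb := continuous_branchFreq θ
  have h := tendsto_integral_exp_phase_sub (-Real.pi) Real.pi
    (A := fun τ k => ((τ + e : ℕ) : ℝ) * (branchFreq θ j' k - branchFreq θ j k) +
      (τ : ℝ) * (branchFreq θ l' k - branchFreq θ l k))
    (δ := fun τ k => ((τ + e : ℕ) : ℝ) * (branchFreq θ j' (k - ε τ) - branchFreq θ j' k) +
      (τ : ℝ) * (branchFreq θ l' (k - ε τ) - branchFreq θ l' k))
    (δ' := fun k => -(ξ / 2 * (branchSign j' + branchSign l') * vel θ k))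
    (fun n => by
      have h1 := hcb j; have h2 := hcb l; have h3 := hcb j'; have h4 := hcb l'
      fun_prop)
    (fun n => by
      have h1 := hcb j'; have h2 := hcb l'
      fun_prop) (by fun_prop)
    (continuous_uncurry_dotProduct_branchAmplitude θ₁ v hs j l j' l') hε hR
    (fun k => by
      have h1 := tendsto_mul_sub_of_hasDerivAt (hasDerivAt_branchFreq hs j' k) hε
        (tendsto_mul_div_two_mul_add e e ξ)
      have h2 := tendsto_mul_sub_of_hasDerivAt (hasDerivAt_branchFreq hs l' k) hε
        (tendsto_mul_div_two_mul_add e 0 ξ)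
      convert! h1.add h2 using 2
      ring)
  have hphase : ∀ (τ : ℕ) (k : ℝ),
      ((τ + e : ℕ) : ℝ) * (branchFreq θ j' k - branchFreq θ j k) +
      (τ : ℝ) * (branchFreq θ l' k - branchFreq θ l k) +
      (((τ + e : ℕ) : ℝ) * (branchFreq θ j' (k - ε τ) - branchFreq θ j' k) +
      (τ : ℝ) * (branchFreq θ l' (k - ε τ) - branchFreq θ l' k)) =
      ((τ + e : ℕ) : ℝ) * (branchFreq θ j' (k - ε τ) - branchFreq θ j k) +
      (τ : ℝ) * (branchFreq θ l' (k - ε τ) - branchFreq θ l k) := fun τ k => by ring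
  simp only [hphase] at h
  by_cases hj : j = j'
  · subst hj
    by_cases hl : l = l'
    · subst hl
      simp only [sub_self, mul_zero, add_zero, Complex.ofReal_zero, zero_mul, Complex.exp_zero,
        one_mul] at h
      simp only [and_self, if_true]
      exact tendsto_sub_nhds_zero_iff.1 h
    · rw [if_neg (by tauto)]
      have hg : Continuous fun k =>
          Complex.exp ((-(ξ / 2 * (branchSign j + branchSign l') * vel θ k) : ℝ) * Complex.I) *
          (star (branchAmplitude θ θ₁ v j l k) ⬝ᵥ branchAmplitude θ θ₁ v j l' k) := by
        have h1 := continuous_branchAmplitude hs θ₁ v j l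
        have h2 := continuous_branchAmplitude hs θ₁ v j l'
        fun_prop
      have hRL := tendsto_integral_exp_freq hs hc hg
      -- The two phases are `freq` and `π - freq`, so their difference is `∓π ± 2 freq`; the
      -- constant `η` contributes only a factor of modulus one.
      obtain ⟨σ, hσ, η, hη⟩ : ∃ σ : ℝ, σ ≠ 0 ∧ ∃ η : ℝ, ∀ k,
          branchFreq θ l' k - branchFreq θ l k = η + σ * freq θ k := by
        cases l <;> cases l' <;> simp_all [branchFreq]
        · exact ⟨2, by norm_num, -Real.pi, fun k => by ring⟩
        · exact ⟨-2, by norm_num, Real.pi, fun k => by ring⟩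
      have hσ' : Tendsto (fun τ : ℕ => (τ : ℝ) * σ) atTop (cocompact ℝ) :=
        (Homeomorph.mulRight₀ σ hσ).isClosedEmbedding.tendsto_cocompact.comp
          (tendsto_natCast_atTop_atTop.mono_right atTop_le_cocompact)
      have h0 := hRL.comp hσ'
      have h1 : Tendsto (fun τ : ℕ => Complex.exp ((τ * η : ℝ) * Complex.I) *
          ∫ k in (-Real.pi)..Real.pi, Complex.exp (((τ * σ) * freq θ k : ℝ) * Complex.I) *
          (Complex.exp ((-(ξ / 2 * (branchSign j + branchSign l') * vel θ k) : ℝ) * Complex.I) *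
          (star (branchAmplitude θ θ₁ v j l k) ⬝ᵥ branchAmplitude θ θ₁ v j l' k))) atTop
          (𝓝 0) := by
        rw [tendsto_zero_iff_norm_tendsto_zero] at h0 ⊢
        refine h0.congr fun τ => ?_
        rw [norm_mul, Complex.norm_exp_ofReal_mul_I, one_mul, Function.comp_apply]
      have h2 := h.add h1
      rw [add_zero] at h2
      refine h2.congr fun τ => ?_
      rw [sub_add_eq_add_sub, sub_eq_iff_eq_add, add_right_inj,
        ← intervalIntegral.integral_const_mul]
      refine intervalIntegral.integral_congr fun k _ => ?_
      simp only [sub_self, mul_zero, zero_add, hη]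
      rw [← mul_assoc, ← Complex.exp_add]
      congr 2
      push_cast
      ring
  · rw [if_neg (by tauto)]
    simpa only [branchAmplitude_orthogonal hs θ₁ v hj, mul_zero, intervalIntegral.integral_zero,
      sub_zero] using h

theorem star_fourierAmplitude_dotProduct (hs : Real.sin θ ≠ 0) (α β : ℂ) {τ m N : ℕ}
    (hN : N = τ + 1 + m) (k k' : ℝ) :
    star (fourierAmplitude θ θ₁ α β τ N k) ⬝ᵥ fourierAmplitude θ θ₁ α β τ N k' =
      ∑ j, ∑ l, ∑ j', ∑ l', Complex.exp (((m : ℝ) * (branchFreq θ j' k' - branchFreq θ j k) +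
        (τ : ℝ) * (branchFreq θ l' k' - branchFreq θ l k) : ℝ) * Complex.I) *
        (star (branchAmplitude θ θ₁ ![α, β] j l k) ⬝ᵥ
          branchAmplitude θ θ₁ ![α, β] j' l' k') := by
  subst hN
  rw [fourierAmplitude_eq_branches hs, fourierAmplitude_eq_branches hs, star_sum, sum_dotProduct]
  refine Finset.sum_congr rfl fun j _ => ?_
  rw [star_sum, sum_dotProduct]
  refine Finset.sum_congr rfl fun l _ => ?_
  rw [dotProduct_sum]
  refine Finset.sum_congr rfl fun j' _ => ?_
  rw [dotProduct_sum]
  refine Finset.sum_congr rfl fun l' _ => ?_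
  rw [star_smul, smul_dotProduct, dotProduct_smul, smul_eq_mul, smul_eq_mul, ← mul_assoc,
    Complex.star_def, ← Complex.exp_conj, ← Complex.exp_add]
  congr 2
  simp only [map_mul, Complex.conj_ofReal, Complex.conj_I]
  push_cast
  ring

/-- Diagonal terms with `j ≠ l` have opposite velocities on the two stretches, hence a limit free of
`ξ`; those with `j = l` give `exp (∓iξ vel)`, weighted by the initial occupation of the branches. -/
theorem tendsto_integral_fourierAmplitude (hs : Real.sin θ ≠ 0) (hc : Real.cos θ ≠ 0) (α β : ℂ)
    (hαβ : ‖α‖ ^ 2 + ‖β‖ ^ 2 = 1) (e : ℕ) (ξ : ℝ) :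
    Tendsto (fun τ : ℕ => ∫ k in (-Real.pi)..Real.pi,
      star (fourierAmplitude θ θ₁ α β τ (2 * τ + (e + 1)) k) ⬝ᵥ
        fourierAmplitude θ θ₁ α β τ (2 * τ + (e + 1)) (k - ξ / ((2 * τ + (e + 1) : ℕ) : ℝ))) atTop
      (𝓝 (∫ k in (-Real.pi)..Real.pi, ((switchProb θ θ₁ k : ℂ) +
        ((1 - switchProb θ θ₁ k : ℝ) : ℂ) * (Real.cos (ξ * vel θ k) -
          branchBias θ ![α, β] k * Real.sin (ξ * vel θ k) * Complex.I)))) := by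
  have hv := continuous_vel hs
  have hcb := continuous_branchFreq θ
  have hca := continuous_branchAmplitude hs θ₁ ![α, β]
  have hlim := tendsto_finsetSum Finset.univ fun j _ => tendsto_finsetSum Finset.univ fun l _ =>
    tendsto_finsetSum Finset.univ fun j' _ => tendsto_finsetSum Finset.univ fun l' _ =>
    tendsto_integral_branch_term θ₁ ![α, β] hs hc e ξ j l j' l'
  convert! hlim using 2
  · rename_i τ
    -- There are `τ` steps before the exceptional one and `τ + e` after it.
    have e1 : 2 * τ + (e + 1) = τ + 1 + (τ + e) := by ring
    simp only [star_fourierAmplitude_dotProduct θ₁ hs α β e1]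
    have hi : ∀ j l j' l', Continuous fun k => Complex.exp ((((τ + e : ℕ) : ℝ) *
        (branchFreq θ j' (k - ξ / ((2 * τ + (e + 1) : ℕ) : ℝ)) - branchFreq θ j k) +
        (τ : ℝ) * (branchFreq θ l' (k - ξ / ((2 * τ + (e + 1) : ℕ) : ℝ)) - branchFreq θ l k) : ℝ) *
          Complex.I) *
        (star (branchAmplitude θ θ₁ ![α, β] j l k) ⬝ᵥ
          branchAmplitude θ θ₁ ![α, β] j' l' (k - ξ / ((2 * τ + (e + 1) : ℕ) : ℝ))) := by
      intro j l j' l'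
      have h1 := hcb j; have h2 := hcb l; have h3 := hcb j'; have h4 := hcb l'
      have h5 := hca j l; have h6 := hca j' l'
      fun_prop
    rw [intervalIntegral.integral_finsetSum fun j _ => (continuous_finsetSum _ fun l _ =>
      continuous_finsetSum _ fun j' _ => continuous_finsetSum _ fun l' _ =>
      hi j l j' l').intervalIntegrable _ _]
    refine Finset.sum_congr rfl fun j _ => ?_
    rw [intervalIntegral.integral_finsetSum fun l _ => (continuous_finsetSum _ fun j' _ =>
      continuous_finsetSum _ fun l' _ => hi j l j' l').intervalIntegrable _ _]
    refine Finset.sum_congr rfl fun l _ => ?_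
    rw [intervalIntegral.integral_finsetSum fun j' _ => (continuous_finsetSum _ fun l' _ =>
      hi j l j' l').intervalIntegrable _ _]
    refine Finset.sum_congr rfl fun j' _ => ?_
    rw [intervalIntegral.integral_finsetSum fun l' _ => (hi j l j' l').intervalIntegrable _ _]
  · have hφ : star ![α, β] ⬝ᵥ ![α, β] = 1 := by
      simp only [dotProduct, Fin.sum_univ_two, Pi.star_apply, Complex.star_def, Complex.conj_mul',
        Matrix.cons_val_zero, Matrix.cons_val_one]
      exact_mod_cast hαβ
    have hI : ∀ j l, IntervalIntegrable (fun k =>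
        Complex.exp ((-(ξ / 2 * (branchSign j + branchSign l) * vel θ k) : ℝ) * Complex.I) *
          (star (branchAmplitude θ θ₁ ![α, β] j l k) ⬝ᵥ branchAmplitude θ θ₁ ![α, β] j l k))
        volume (-Real.pi) Real.pi := fun j l => by
      have h1 := hca j l
      exact Continuous.intervalIntegrable (by fun_prop) _ _
    simp only [Fintype.sum_bool, Bool.false_eq_true, Bool.true_eq_false, and_true, and_false,
      if_true, if_false, add_zero, zero_add]
    rw [← intervalIntegral.integral_add (hI _ _) (hI _ _),
      ← intervalIntegral.integral_add (hI _ _) (hI _ _),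
      ← intervalIntegral.integral_add ((hI _ _).add (hI _ _)) ((hI _ _).add (hI _ _))]
    refine intervalIntegral.integral_congr fun k _ => ?_
    have t1 := branchAmplitude_self hs θ₁ ![α, β] hφ true k
    have t2 := branchAmplitude_self hs θ₁ ![α, β] hφ false k
    have t3 := branchAmplitude_not hs θ₁ ![α, β] hφ true k
    have t4 := branchAmplitude_not hs θ₁ ![α, β] hφ false k
    simp only [Bool.not_true, Bool.not_false] at t3 t4
    have e1 : Complex.exp ((-(ξ * vel θ k) : ℝ) * Complex.I) =
        Real.cos (ξ * vel θ k) - Real.sin (ξ * vel θ k) * Complex.I := by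
      rw [exp_mul_I_eq, Real.cos_neg, Real.sin_neg]
      push_cast
      ring
    simp only [t1, t2, t3, t4, branchSign, if_true, Bool.false_eq_true, if_false]
    have f1 : -(ξ / 2 * ((1 : ℝ) + 1) * vel θ k) = -(ξ * vel θ k) := by ring
    have f2 : -(ξ / 2 * ((-1 : ℝ) + -1) * vel θ k) = ξ * vel θ k := by ring
    have f3 : -(ξ / 2 * ((1 : ℝ) + -1) * vel θ k) = 0 := by ring
    have f4 : -(ξ / 2 * ((-1 : ℝ) + 1) * vel θ k) = 0 := by ring
    rw [f1, f2, f3, f4, e1, exp_mul_I_eq (ξ * vel θ k)]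
    simp only [Complex.ofReal_zero, zero_mul, Complex.exp_zero]
    push_cast
    ring

end Asymptotics

/-! ### From momentum averages to the limit density -/

section Density

variable {θ : ℝ} (θ₁ : ℝ) (α β : ℂ)

/-- The coefficient of the asymmetry of the limit law caused by the initial state. -/
noncomputable def asymmetry (θ : ℝ) (α β : ℂ) : ℝ :=
  ‖α‖ ^ 2 - ‖β‖ ^ 2 + (α * starRingEnd ℂ β + starRingEnd ℂ α * β).re * Real.sin θ / Real.cos θ

theorem gap_neg (φ k : ℝ) : gap φ (-k) = gap φ k := by simp [gap]

theorem gap_pi_sub (φ k : ℝ) : gap φ (Real.pi - k) = gap φ k := by simp [gap]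

theorem vel_neg (φ k : ℝ) : vel φ (-k) = vel φ k := by simp [vel, gap_neg]

theorem vel_pi_sub (φ k : ℝ) : vel φ (Real.pi - k) = -vel φ k := by
  simp [vel, gap_pi_sub, neg_div]

theorem switchProb_neg (φ ψ k : ℝ) : switchProb φ ψ (-k) = switchProb φ ψ k := by
  simp [switchProb, gap_neg]

theorem switchProb_pi_sub (φ ψ k : ℝ) : switchProb φ ψ (Real.pi - k) = switchProb φ ψ k := by
  simp [switchProb, gap_pi_sub, neg_div]

theorem continuous_switchProb (hs : Real.sin θ ≠ 0) : Continuous (switchProb θ θ₁) := by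
  have h := continuous_gap θ
  unfold switchProb
  exact (Continuous.div (by fun_prop) h fun k => (gap_pos hs k).ne').pow 2

theorem continuous_branchBias (hs : Real.sin θ ≠ 0) (v : Fin 2 → ℂ) :
    Continuous (branchBias θ v) := by
  have h1 : Continuous fun k => ((gap θ k)⁻¹ : ℂ) :=
    (Complex.continuous_ofReal.comp (continuous_gap θ)).inv₀ fun k =>
      Complex.ofReal_ne_zero.2 (gap_pos hs k).ne'
  have h2 := continuous_hermPart θ
  unfold branchBias involution
  fun_prop

/-- The part of the bias proportional to `sin k` is odd and cancels; what remains is proportional to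
`cos k / gap`, that is, to `vel`. -/
theorem branchBias_add_neg (hc : Real.cos θ ≠ 0) (k : ℝ) :
    branchBias θ ![α, β] k + branchBias θ ![α, β] (-k) = 2 * (asymmetry θ α β * vel θ k : ℝ) := by
  have hc' : (Real.cos θ : ℂ) ≠ 0 := Complex.ofReal_ne_zero.2 hc
  have hre : (((α * starRingEnd ℂ β + starRingEnd ℂ α * β).re : ℝ) : ℂ) =
      α * starRingEnd ℂ β + starRingEnd ℂ α * β := by
    rw [← Complex.conj_eq_iff_re]
    simp only [map_add, map_mul, Complex.conj_conj]
    ring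
  have hα := Complex.conj_mul' α
  have hβ := Complex.conj_mul' β
  rw [asymmetry, vel]
  push_cast [hre, ← hα, ← hβ, -Complex.ofReal_cos, -Complex.ofReal_sin]
  simp only [branchBias, involution, gap_neg, smul_mulVec, dotProduct_smul, smul_eq_mul]
  simp only [hermPart, dotProduct, Matrix.mulVec, Fin.sum_univ_two, Pi.star_apply,
    Complex.star_def, of_apply,
    Matrix.cons_val_zero, Matrix.cons_val_one, exp_mul_I_eq, exp_neg_mul_I_eq, Real.cos_neg,
    Real.sin_neg]
  push_cast [-Complex.ofReal_cos, -Complex.ofReal_sin]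
  field_simp
  ring

theorem integral_neg_pi_pi_eq {F : ℝ → ℂ} (hF : Continuous F) :
    ∫ k in (-Real.pi)..Real.pi, F k = ∫ k in (0 : ℝ)..Real.pi, (F k + F (-k)) := by
  rw [intervalIntegral.integral_add (hF.intervalIntegrable _ _)
    ((by fun_prop : Continuous fun k => F (-k)).intervalIntegrable _ _),
    ← intervalIntegral.integral_add_adjacent_intervals (hF.intervalIntegrable _ 0)
      (hF.intervalIntegrable _ _),
    intervalIntegral.integral_comp_neg, neg_zero, add_comm]

theorem integral_limit_eq (hs : Real.sin θ ≠ 0) (hc : Real.cos θ ≠ 0) (ξ : ℝ) :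
    ∫ k in (-Real.pi)..Real.pi, ((switchProb θ θ₁ k : ℂ) +
        ((1 - switchProb θ θ₁ k : ℝ) : ℂ) * (Real.cos (ξ * vel θ k) -
          branchBias θ ![α, β] k * Real.sin (ξ * vel θ k) * Complex.I)) =
      2 * ((∫ k in (0 : ℝ)..Real.pi, switchProb θ θ₁ k : ℝ) +
        ∫ k in (0 : ℝ)..Real.pi, ((1 - switchProb θ θ₁ k : ℝ) : ℂ) * (Real.cos (ξ * vel θ k) -
          (asymmetry θ α β * vel θ k : ℝ) * Real.sin (ξ * vel θ k) * Complex.I)) := by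
  have h1 := continuous_switchProb θ₁ hs
  have h2 := continuous_branchBias hs ![α, β]
  have h3 := continuous_vel hs
  rw [integral_neg_pi_pi_eq (by fun_prop), ← intervalIntegral.integral_ofReal,
    ← intervalIntegral.integral_add (Continuous.intervalIntegrable (by fun_prop) _ _)
      (Continuous.intervalIntegrable (by fun_prop) _ _), ← intervalIntegral.integral_const_mul]
  refine intervalIntegral.integral_congr fun k _ => ?_
  simp only [switchProb_neg, vel_neg]
  linear_combination (-((1 - switchProb θ θ₁ k : ℝ) : ℂ) * Real.sin (ξ * vel θ k) * Complex.I) *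
    branchBias_add_neg α β hc k

/-- The reflection `k ↦ π - k` preserves `switchProb` and reverses `vel`. Averaging the left
integrand over it leaves the even part of the exponential with weight `1` and the odd part with
weight `-K * vel`. -/
theorem integral_exp_vel_eq (hs : Real.sin θ ≠ 0) (K ξ : ℝ) :
    ∫ k in (0 : ℝ)..Real.pi, (((1 - switchProb θ θ₁ k) * (1 - K * vel θ k) : ℝ) : ℂ) *
        Complex.exp ((ξ * vel θ k : ℝ) * Complex.I) =
      ∫ k in (0 : ℝ)..Real.pi, ((1 - switchProb θ θ₁ k : ℝ) : ℂ) * (Real.cos (ξ * vel θ k) -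
          (K * vel θ k : ℝ) * Real.sin (ξ * vel θ k) * Complex.I) := by
  have h1 := continuous_switchProb θ₁ hs
  have h3 := continuous_vel hs
  set F : ℝ → ℂ := fun k => (((1 - switchProb θ θ₁ k) * (1 - K * vel θ k) : ℝ) : ℂ) *
        Complex.exp ((ξ * vel θ k : ℝ) * Complex.I) with hF
  have hFc : Continuous F := by fun_prop
  have h : ∫ k in (0 : ℝ)..Real.pi, F (Real.pi - k) = ∫ k in (0 : ℝ)..Real.pi, F k := by
    rw [intervalIntegral.integral_comp_sub_left]
    simp
  have h2 : ∫ k in (0 : ℝ)..Real.pi, F k =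
      ∫ k in (0 : ℝ)..Real.pi, (2⁻¹ : ℂ) * (F k + F (Real.pi - k)) := by
    rw [intervalIntegral.integral_const_mul,
      intervalIntegral.integral_add (hFc.intervalIntegrable _ _)
      (Continuous.intervalIntegrable (by fun_prop) _ _), h]
    ring
  rw [h2]
  refine intervalIntegral.integral_congr fun k _ => ?_
  simp only [hF, switchProb_pi_sub, vel_pi_sub, exp_mul_I_eq, mul_neg, Real.cos_neg, Real.sin_neg]
  push_cast
  ring

/-! ### The substitution `x = vel θ k` on the half period -/

theorem hasDerivAt_vel (hs : Real.sin θ ≠ 0) (k : ℝ) :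
    HasDerivAt (vel θ) (-(Real.cos θ * Real.sin θ ^ 2 * Real.sin k / gap θ k ^ 3)) k := by
  have hg := gap_pos hs k
  have h2 : gap θ k ^ 2 = 1 - (Real.cos θ * Real.sin k) ^ 2 := by rw [gap_sq, one_sub_sq_eq]
  have h0 : 1 - (Real.cos θ * Real.sin k) ^ 2 ≠ 0 := by rw [← h2]; positivity
  have hG : HasDerivAt (gap θ)
      (-(2 * (Real.cos θ * Real.sin k) * (Real.cos θ * Real.cos k)) / (2 * gap θ k)) k := by
    have := ((((Real.hasDerivAt_sin k).const_mul (Real.cos θ)).fun_pow 2).const_sub 1).sqrt h0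
    simpa [gap] using! this
  convert! ((Real.hasDerivAt_cos k).const_mul (Real.cos θ)).fun_div hG hg.ne' using 1
  have h3 := Real.sin_sq_add_cos_sq θ
  have h4 := Real.sin_sq_add_cos_sq k
  field_simp
  linear_combination (-(Real.cos θ * Real.sin k)) * h3 + Real.cos θ * Real.sin k * h2 -
    Real.cos θ ^ 3 * Real.sin k * h4

theorem one_sub_vel_sq (hs : Real.sin θ ≠ 0) (k : ℝ) :
    1 - vel θ k ^ 2 = Real.sin θ ^ 2 / gap θ k ^ 2 := by
  have hg := (gap_pos hs k).ne'
  rw [vel, div_pow]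
  field_simp
  linear_combination gap_sq θ k

theorem cos_sq_sub_vel_sq (hs : Real.sin θ ≠ 0) (k : ℝ) :
    Real.cos θ ^ 2 - vel θ k ^ 2 =
      (|Real.cos θ| * |Real.sin θ| * |Real.sin k| / gap θ k) ^ 2 := by
  have hg := (gap_pos hs k).ne'
  rw [vel, div_pow, div_pow, mul_pow, mul_pow, mul_pow, sq_abs, sq_abs, sq_abs]
  field_simp
  linear_combination Real.cos θ ^ 2 * (gap_sq θ k - Real.sin θ ^ 2 * Real.sin_sq_add_cos_sq k +
    Real.cos k ^ 2 * Real.sin_sq_add_cos_sq θ)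

/-- By `one_sub_vel_sq` the velocity determines `gap`, hence `cos k`, and `cos` is injective on the
half period. -/
theorem injOn_vel (hs : Real.sin θ ≠ 0) (hc : Real.cos θ ≠ 0) :
    Set.InjOn (vel θ) (Set.Ioo 0 Real.pi) := by
  intro x hx y hy hxy
  have hgx := gap_pos hs x
  have hgy := gap_pos hs y
  have h : Real.sin θ ^ 2 / gap θ x ^ 2 = Real.sin θ ^ 2 / gap θ y ^ 2 := by
    rw [← one_sub_vel_sq hs, ← one_sub_vel_sq hs, hxy]
  have hg : gap θ x = gap θ y := by
    have h1 : gap θ x ^ 2 = gap θ y ^ 2 := by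
      field_simp at h
      exact h.symm
    exact (pow_left_inj₀ hgx.le hgy.le two_ne_zero).1 h1
  rw [vel, vel, hg, div_left_inj' hgy.ne', mul_right_inj' hc] at hxy
  exact Real.injOn_cos (Set.Ioo_subset_Icc_self hx) (Set.Ioo_subset_Icc_self hy) hxy

theorem image_vel (hs : Real.sin θ ≠ 0) (hc : Real.cos θ ≠ 0) :
    vel θ '' Set.Ioo 0 Real.pi = Set.Ioo (-|Real.cos θ|) |Real.cos θ| := by
  have h0 : vel θ 0 = Real.cos θ := by simp [vel, gap]
  have hpi : vel θ Real.pi = -Real.cos θ := by simp [vel, gap]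
  refine Set.Subset.antisymm ?_ ?_
  · rintro _ ⟨k, hk, rfl⟩
    have h := cos_sq_sub_vel_sq hs k
    have hk' := Real.sin_pos_of_pos_of_lt_pi hk.1 hk.2
    have hg := gap_pos hs k
    have : 0 < Real.cos θ ^ 2 - vel θ k ^ 2 := by rw [h]; positivity
    exact abs_lt.1 (sq_lt_sq.1 (by linarith))
  · have hcont := (continuous_vel hs).continuousOn (s := Set.Icc 0 Real.pi)
    rcases hc.lt_or_gt with hneg | hpos
    · have := intermediate_value_Ioo Real.pi_pos.le hcont
      rw [h0, hpi] at this
      rwa [abs_of_neg hneg, neg_neg]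
    · have := intermediate_value_Ioo' Real.pi_pos.le hcont
      rw [h0, hpi] at this
      rwa [abs_of_pos hpos]

/-- The factor `1 - x²` cancels the one in the denominator of `density`; at `x = vel θ k` the other
factor is `cos² θ (1 - switchProb θ θ₁ k)`. -/
theorem density_factor_eq (x : ℝ) : a₂ θ θ₁ * x ^ 4 + a₁ θ θ₁ * x ^ 2 + a₀ θ =
    (Real.cos θ ^ 2 -
      (Real.cos θ₁ * Real.sin θ - Real.sin θ₁ * Real.cos θ) ^ 2 * x ^ 2) * (1 - x ^ 2) := by
  have h1 := Real.sin_sq_add_cos_sq θ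
  have h2 := Real.sin_sq_add_cos_sq θ₁
  simp only [a₀, a₁, a₂]
  linear_combination (Real.cos θ₁ ^ 2 * x ^ 2) * h1 - Real.cos θ ^ 2 * x ^ 2 * h2

theorem abs_deriv_mul_density (hs : Real.sin θ ≠ 0) (hc : Real.cos θ ≠ 0) {k : ℝ}
    (hk : k ∈ Set.Ioo 0 Real.pi) :
    |-(Real.cos θ * Real.sin θ ^ 2 * Real.sin k / gap θ k ^ 3)| * density θ θ₁ α β (vel θ k) =
      Real.pi⁻¹ * ((1 - switchProb θ θ₁ k) * (1 - asymmetry θ α β * vel θ k)) := by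
  have hg := gap_pos hs k
  have hsk := Real.sin_pos_of_pos_of_lt_pi hk.1 hk.2
  have hpi := Real.pi_pos
  have hmem : vel θ k ∈ Set.Ioo (-|Real.cos θ|) |Real.cos θ| := by
    rw [← image_vel hs hc]
    exact ⟨k, hk, rfl⟩
  have hp : Real.cos θ ^ 2 - (Real.cos θ₁ * Real.sin θ - Real.sin θ₁ * Real.cos θ) ^ 2 *
      vel θ k ^ 2 = Real.cos θ ^ 2 * (1 - switchProb θ θ₁ k) := by
    rw [vel, switchProb]
    ring
  have h1 : 1 - vel θ k ^ 2 ≠ 0 := by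
    rw [one_sub_vel_sq hs]
    positivity
  rw [density, Set.indicator_of_mem hmem, density_factor_eq, mul_div_mul_right _ _ h1, hp,
    mul_div_cancel_left₀ _ (pow_ne_zero 2 hc), cos_sq_sub_vel_sq hs,
    Real.sqrt_sq (by positivity), one_sub_vel_sq hs, abs_neg, abs_div, abs_mul, abs_mul,
    abs_of_pos hsk, abs_of_pos (pow_pos hg 3), abs_pow, ← sq_abs (Real.sin θ), ← asymmetry]
  have hs' : |Real.sin θ| ≠ 0 := abs_ne_zero.2 hs
  have hc' : |Real.cos θ| ≠ 0 := abs_ne_zero.2 hc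
  field_simp

theorem density_eq_zero {x : ℝ} (hx : x ∉ Set.Ioo (-|Real.cos θ|) |Real.cos θ|) :
    density θ θ₁ α β x = 0 :=
  Set.indicator_of_notMem hx _

/-- The Jacobian absorbs the inverse square root singularities at `±|cos θ|`: in the variable `k`
the integrand is the restriction of a continuous function on `[0, π]`. -/
theorem integrable_density (hs : Real.sin θ ≠ 0) (hc : Real.cos θ ≠ 0) :
    Integrable (density θ θ₁ α β) := by
  have hsupp : Function.support (density θ θ₁ α β) ⊆ vel θ '' Set.Ioo 0 Real.pi := fun x hx => by
    rw [image_vel hs hc]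
    by_contra h
    exact hx (density_eq_zero θ₁ α β h)
  rw [← integrableOn_iff_integrable_of_support_subset hsupp,
    integrableOn_image_iff_integrableOn_abs_deriv_smul measurableSet_Ioo
      (fun k _ => (hasDerivAt_vel hs k).hasDerivWithinAt) (injOn_vel hs hc)]
  have h1 := continuous_switchProb θ₁ hs
  have h3 := continuous_vel hs
  have : IntegrableOn (fun k => Real.pi⁻¹ * ((1 - switchProb θ θ₁ k) *
      (1 - asymmetry θ α β * vel θ k))) (Set.Ioo 0 Real.pi) :=
    (Continuous.integrableOn_Icc (by fun_prop)).mono_set Set.Ioo_subset_Icc_self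
  exact this.congr_fun (fun k hk => (abs_deriv_mul_density θ₁ α β hs hc hk).symm)
    measurableSet_Ioo

theorem integral_density_mul (hs : Real.sin θ ≠ 0) (hc : Real.cos θ ≠ 0) (g : ℝ → ℂ) :
    ∫ x, (density θ θ₁ α β x : ℂ) * g x =
      (Real.pi⁻¹ : ℝ) * ∫ k in (0 : ℝ)..Real.pi,
        (((1 - switchProb θ θ₁ k) * (1 - asymmetry θ α β * vel θ k) : ℝ) : ℂ) * g (vel θ k) := by
  have hz : ∀ x ∉ vel θ '' Set.Ioo 0 Real.pi, (density θ θ₁ α β x : ℂ) * g x = 0 := fun x hx => by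
    rw [image_vel hs hc] at hx
    rw [density_eq_zero θ₁ α β hx, Complex.ofReal_zero, zero_mul]
  rw [← setIntegral_eq_integral_of_forall_compl_eq_zero hz,
    integral_image_eq_integral_abs_deriv_smul measurableSet_Ioo
      (fun k _ => (hasDerivAt_vel hs k).hasDerivWithinAt) (injOn_vel hs hc),
    intervalIntegral.integral_of_le Real.pi_pos.le, integral_Ioc_eq_integral_Ioo,
    ← integral_const_mul]
  refine setIntegral_congr_fun measurableSet_Ioo fun k hk => ?_
  simp only [Complex.real_smul]
  rw [← mul_assoc, ← Complex.ofReal_mul, abs_deriv_mul_density θ₁ α β hs hc hk,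
    Complex.ofReal_mul, mul_assoc]

/-- The usual primitive `(k - q arctan (q tan k)) / (1 - q²)` jumps at `π/2`. Writing `arctan (q tan
k)` as `k` minus the arctangent of `tan (k - arctan (q tan k))`, expanded by the subtraction
formula, gives a primitive smooth on the whole line. The arctangent vanishes at `0` and `π`, so the
integral over `[0, π]` is `π / (1 + q)`. -/
theorem hasDerivAt_arctan_sin_mul_cos_div {q : ℝ} (hq : 0 < q) (hq1 : q ≠ 1) (k : ℝ) :
    HasDerivAt (fun k => (k + q / (1 - q) * Real.arctan ((1 - q) * (Real.sin k * Real.cos k) /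
      (Real.cos k ^ 2 + q * Real.sin k ^ 2))) / (1 + q))
      (Real.cos k ^ 2 / (Real.cos k ^ 2 + q ^ 2 * Real.sin k ^ 2)) k := by
  have h := Real.sin_sq_add_cos_sq k
  have hd : 0 < Real.cos k ^ 2 + q * Real.sin k ^ 2 := by
    rcases eq_or_ne (Real.sin k) 0 with h0 | h0
    · rw [h0] at h ⊢
      nlinarith
    · positivity
  have hd2 : 0 < Real.cos k ^ 2 + q ^ 2 * Real.sin k ^ 2 := by
    rcases eq_or_ne (Real.sin k) 0 with h0 | h0
    · rw [h0] at h ⊢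
      nlinarith
    · positivity
  have hn := (((Real.hasDerivAt_sin k).fun_mul (Real.hasDerivAt_cos k)).const_mul (1 - q))
  have hD := ((Real.hasDerivAt_cos k).fun_pow 2).fun_add
    (((Real.hasDerivAt_sin k).fun_pow 2).const_mul q)
  have := (((hasDerivAt_id k).fun_add
    ((hn.fun_div hD hd.ne').arctan.const_mul (q / (1 - q)))).div_const (1 + q))
  convert! this using 1
  set S := Real.sin k
  set C := Real.cos k
  have hq1' : 1 - q ≠ 0 := sub_ne_zero.2 hq1.symm
  have e : 1 + ((1 - q) * (S * C) / (C ^ 2 + q * S ^ 2)) ^ 2 =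
      (C ^ 2 + q ^ 2 * S ^ 2) / (C ^ 2 + q * S ^ 2) ^ 2 := by
    field_simp
    linear_combination (C ^ 2 + q ^ 2 * S ^ 2) * h
  rw [e]
  have h' : (C * C + S * -S) * (C ^ 2 + q * S ^ 2) -
      S * C * ((2 * C * -S) + q * (2 * S * C)) = C ^ 2 - q * S ^ 2 := by
    linear_combination (C ^ 2 - q * S ^ 2) * h
  have e2 : (1 - q) * (C * C + S * -S) * (C ^ 2 + q * S ^ 2) - (1 - q) * (S * C) *
      (((2 : ℕ) : ℝ) * C ^ (2 - 1) * -S + q * (((2 : ℕ) : ℝ) * S ^ (2 - 1) * C)) =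
      (1 - q) * (C ^ 2 - q * S ^ 2) := by
    rw [← h']
    norm_num
    ring
  rw [e2]
  field_simp
  ring

theorem integral_switchProb (hs : Real.sin θ ≠ 0) (hc : Real.cos θ ≠ 0) :
    ∫ k in (0 : ℝ)..Real.pi, switchProb θ θ₁ k = Real.pi * atom θ θ₁ := by
  have hq : 0 < |Real.sin θ| := abs_pos.2 hs
  have hq1 : |Real.sin θ| ≠ 1 := by
    intro h
    have := Real.sin_sq_add_cos_sq θ
    rw [← sq_abs (Real.sin θ), h] at this
    exact hc (pow_eq_zero_iff two_ne_zero |>.1 (by linarith))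
  have hp : ∀ k, switchProb θ θ₁ k =
      (Real.cos θ₁ * Real.sin θ - Real.sin θ₁ * Real.cos θ) ^ 2 *
        (Real.cos k ^ 2 / (Real.cos k ^ 2 + |Real.sin θ| ^ 2 * Real.sin k ^ 2)) := fun k => by
    have e : gap θ k ^ 2 = Real.cos k ^ 2 + |Real.sin θ| ^ 2 * Real.sin k ^ 2 := by
      rw [gap_sq, sq_abs]
      linear_combination (-Real.sin θ ^ 2) * Real.sin_sq_add_cos_sq k +
        Real.cos k ^ 2 * Real.sin_sq_add_cos_sq θ
    rw [← e, switchProb]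
    ring
  have hcont : Continuous fun k =>
      Real.cos k ^ 2 / (Real.cos k ^ 2 + |Real.sin θ| ^ 2 * Real.sin k ^ 2) := by
    refine Continuous.div (by fun_prop) (by fun_prop) fun k => ?_
    have h := Real.sin_sq_add_cos_sq k
    rcases eq_or_ne (Real.sin k) 0 with h0 | h0
    · rw [h0] at h ⊢
      nlinarith
    · positivity
  simp only [hp]
  rw [intervalIntegral.integral_const_mul, intervalIntegral.integral_eq_sub_of_hasDerivAt
    (fun k _ => hasDerivAt_arctan_sin_mul_cos_div hq hq1 k) (hcont.intervalIntegrable _ _)]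
  simp [atom]
  ring

/-- Cauchy–Schwarz between `(cos θ, sin θ)` and `(‖α‖² - ‖β‖², 2 Re (α β̄))`; the latter consists of
two Bloch coordinates of a unit state, so its length is at most one. -/
theorem asymmetry_mul_cos_sq_le (hc : Real.cos θ ≠ 0) (hαβ : ‖α‖ ^ 2 + ‖β‖ ^ 2 = 1) :
    (asymmetry θ α β * Real.cos θ) ^ 2 ≤ 1 := by
  have h1 : asymmetry θ α β * Real.cos θ = (‖α‖ ^ 2 - ‖β‖ ^ 2) * Real.cos θ +
      (α * starRingEnd ℂ β + starRingEnd ℂ α * β).re * Real.sin θ := by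
    rw [asymmetry]
    field_simp
  have h2 : (α * starRingEnd ℂ β + starRingEnd ℂ α * β).re ^ 2 ≤ 4 * (‖α‖ ^ 2 * ‖β‖ ^ 2) := by
    simp only [← Complex.normSq_eq_norm_sq, Complex.normSq_apply, Complex.add_re, Complex.mul_re,
      Complex.conj_re, Complex.conj_im]
    nlinarith [sq_nonneg (α.re * β.im - α.im * β.re)]
  set A := ‖α‖ ^ 2
  set B := ‖β‖ ^ 2
  set r := (α * starRingEnd ℂ β + starRingEnd ℂ α * β).re
  have h3 : (A - B) ^ 2 + r ^ 2 ≤ 1 := by nlinarith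
  have h4 := Real.sin_sq_add_cos_sq θ
  rw [h1]
  nlinarith [sq_nonneg ((A - B) * Real.sin θ - r * Real.cos θ)]

theorem density_nonneg (hc : Real.cos θ ≠ 0) (hαβ : ‖α‖ ^ 2 + ‖β‖ ^ 2 = 1) (x : ℝ) :
    0 ≤ density θ θ₁ α β x := by
  refine Set.indicator_nonneg (fun x hx => ?_) x
  have hx2 : x ^ 2 < Real.cos θ ^ 2 := sq_lt_sq.2 (abs_lt.2 hx)
  have hx1 : 0 < 1 - x ^ 2 := by linarith [Real.cos_sq_le_one θ]
  have hpi := Real.pi_pos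
  rw [density_factor_eq, ← asymmetry]
  have hD : (Real.cos θ₁ * Real.sin θ - Real.sin θ₁ * Real.cos θ) ^ 2 ≤ 1 := by
    -- Being the sine of `θ - θ₁`, this coefficient has square at most one, so `x² < cos² θ` makes
    -- the quadratic factor nonnegative.
    rw [show Real.cos θ₁ * Real.sin θ - Real.sin θ₁ * Real.cos θ = Real.sin (θ - θ₁) by
      rw [Real.sin_sub]; ring]
    exact Real.sin_sq_le_one _
  have h1 : 0 ≤ Real.cos θ ^ 2 -
      (Real.cos θ₁ * Real.sin θ - Real.sin θ₁ * Real.cos θ) ^ 2 * x ^ 2 := by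
    nlinarith [sq_nonneg x]
  have h2 : 0 ≤ 1 - asymmetry θ α β * x := by
    have h := asymmetry_mul_cos_sq_le α β hc hαβ
    have h3 : (asymmetry θ α β * x) ^ 2 ≤ 1 := by
      nlinarith [sq_nonneg (asymmetry θ α β)]
    linarith [(abs_le.1 ((sq_le_one_iff_abs_le_one _).1 h3)).2]
  positivity

theorem density_self (hc : Real.cos θ ≠ 0) : density θ θ α β = usualDensity θ α β := by
  refine Set.indicator_congr fun x hx => ?_
  have hx2 : x ^ 2 < Real.cos θ ^ 2 := sq_lt_sq.2 (abs_lt.2 hx)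
  have hx1 : 1 - x ^ 2 ≠ 0 := by linarith [Real.cos_sq_le_one θ]
  rw [density_factor_eq, show Real.cos θ * Real.sin θ - Real.sin θ * Real.cos θ = 0 by ring]
  field_simp
  ring

end Density

/-! ### Identification of the limit and convergence in distribution -/

section Limit

variable {θ : ℝ} (θ₁ : ℝ) (α β : ℂ)

theorem atom_nonneg (θ θ₁ : ℝ) : 0 ≤ atom θ θ₁ := by
  unfold atom
  positivity

theorem integral_exp_mul_density (hs : Real.sin θ ≠ 0) (hc : Real.cos θ ≠ 0) (ξ : ℝ) :
    (atom θ θ₁ : ℂ) +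
      ∫ x, (density θ θ₁ α β x : ℂ) * Complex.exp ((ξ * x : ℝ) * Complex.I) =
      (2 * Real.pi : ℂ)⁻¹ * ∫ k in (-Real.pi)..Real.pi, ((switchProb θ θ₁ k : ℂ) +
        ((1 - switchProb θ θ₁ k : ℝ) : ℂ) * (Real.cos (ξ * vel θ k) -
          branchBias θ ![α, β] k * Real.sin (ξ * vel θ k) * Complex.I)) := by
  have hpi : (Real.pi : ℂ) ≠ 0 := Complex.ofReal_ne_zero.2 Real.pi_ne_zero
  rw [integral_density_mul θ₁ α β hs hc, integral_exp_vel_eq θ₁ hs, integral_limit_eq θ₁ α β hs hc,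
    integral_switchProb θ₁ hs hc, Complex.ofReal_mul Real.pi, Complex.ofReal_inv]
  have key : ∀ A J : ℂ, A + (Real.pi : ℂ)⁻¹ * J =
      (2 * Real.pi : ℂ)⁻¹ * (2 * (Real.pi * A + J)) := fun A J => by field_simp
  exact key _ _

/-- The case `ξ = 0` of the identity for characteristic functions: there the momentum integrand is
identically `1`. -/
theorem atom_add_integral_density (hs : Real.sin θ ≠ 0) (hc : Real.cos θ ≠ 0) :
    atom θ θ₁ + ∫ x, density θ θ₁ α β x = 1 := by
  have h := integral_exp_mul_density θ₁ α β hs hc 0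
  have hpi : (Real.pi : ℂ) ≠ 0 := Complex.ofReal_ne_zero.2 Real.pi_ne_zero
  simp only [zero_mul, Complex.ofReal_zero, Complex.exp_zero, mul_one, Real.cos_zero,
    Real.sin_zero, mul_zero, sub_zero, Complex.ofReal_one, integral_complex_ofReal] at h
  have e : ∀ k, (switchProb θ θ₁ k : ℂ) + ((1 - switchProb θ θ₁ k : ℝ) : ℂ) = 1 := fun k => by
    push_cast
    ring
  simp only [e, intervalIntegral.integral_const, Complex.real_smul] at h
  have h2 : (2 * Real.pi : ℂ)⁻¹ * (((Real.pi - -Real.pi : ℝ) : ℂ) * 1) = 1 := by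
    push_cast
    field_simp
    ring
  rw [h2] at h
  exact_mod_cast h

theorem isProbabilityMeasure_limitLaw (hs : Real.sin θ ≠ 0) (hc : Real.cos θ ≠ 0)
    (hαβ : ‖α‖ ^ 2 + ‖β‖ ^ 2 = 1) : IsProbabilityMeasure (limitLaw θ θ₁ α β) := by
  constructor
  rw [limitLaw, Measure.add_apply, Measure.smul_apply, measure_univ, smul_eq_mul, mul_one,
    withDensity_apply _ MeasurableSet.univ, Measure.restrict_univ,
    ← ofReal_integral_eq_lintegral_ofReal (integrable_density θ₁ α β hs hc)
      (ae_of_all _ (density_nonneg θ₁ α β hc hαβ)),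
    ← ENNReal.ofReal_add (atom_nonneg θ θ₁)
      (integral_nonneg (density_nonneg θ₁ α β hc hαβ)),
    atom_add_integral_density θ₁ α β hs hc, ENNReal.ofReal_one]

theorem charFun_limitLaw (hs : Real.sin θ ≠ 0) (hc : Real.cos θ ≠ 0)
    (hαβ : ‖α‖ ^ 2 + ‖β‖ ^ 2 = 1) (ξ : ℝ) :
    charFun (limitLaw θ θ₁ α β) ξ = (atom θ θ₁ : ℂ) +
      ∫ x, (density θ θ₁ α β x : ℂ) * Complex.exp ((ξ * x : ℝ) * Complex.I) := by
  have hP := isProbabilityMeasure_limitLaw θ₁ α β hs hc hαβ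
  have hint : Integrable (fun x : ℝ => Complex.exp (ξ * x * Complex.I)) (limitLaw θ θ₁ α β) := by
    refine (integrable_const (1 : ℝ)).mono' (by fun_prop) (ae_of_all _ fun x => ?_)
    rw [← Complex.ofReal_mul, Complex.norm_exp_ofReal_mul_I]
  have hint' := integrable_add_measure.1 hint
  rw [charFun_apply_real, limitLaw, integral_add_measure hint'.1 hint'.2, integral_smul_measure,
    integral_dirac, ENNReal.toReal_ofReal (atom_nonneg θ θ₁),
    integral_withDensity_eq_integral_toReal_smul₀
      (integrable_density θ₁ α β hs hc).aemeasurable.ennreal_ofReal (by simp)]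
  congr 1
  · simp
  · refine integral_congr_ae (ae_of_all _ fun x => ?_)
    simp only
    rw [ENNReal.toReal_ofReal (density_nonneg θ₁ α β hc hαβ x), Complex.real_smul,
      Complex.ofReal_mul]

theorem tendsto_charFun_walkLaw (hs : Real.sin θ ≠ 0) (hc : Real.cos θ ≠ 0)
    (hαβ : ‖α‖ ^ 2 + ‖β‖ ^ 2 = 1) (e : ℕ) (ξ : ℝ) :
    Tendsto (fun τ : ℕ => charFun ((walkLaw θ θ₁ α β τ (2 * τ + (e + 1))).map
      fun ω : ℤ => (ω : ℝ) / ((2 * τ + (e + 1) : ℕ) : ℝ)) ξ) atTop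
      (𝓝 (charFun (limitLaw θ θ₁ α β) ξ)) := by
  rw [charFun_limitLaw θ₁ α β hs hc hαβ, integral_exp_mul_density θ₁ α β hs hc]
  simp only [charFun_map_walkLaw _ _ _ _ _ hαβ]
  exact (tendsto_integral_fourierAmplitude θ₁ hs hc α β hαβ e ξ).const_mul _

/-- Lévy's continuity theorem. The form `e + 1` keeps the time positive for every `τ`, including `τ
= 0`. -/
theorem tendstoInDistribution_walkLaw (hs : Real.sin θ ≠ 0) (hc : Real.cos θ ≠ 0)
    (hαβ : ‖α‖ ^ 2 + ‖β‖ ^ 2 = 1) [∀ τ t : ℕ, IsProbabilityMeasure (walkLaw θ θ₁ α β τ t)]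
    [IsProbabilityMeasure (limitLaw θ θ₁ α β)] (e : ℕ) :
    TendstoInDistribution
      (fun (τ : ℕ) (ω : ℤ) => (ω : ℝ) / ((2 * τ + (e + 1) : ℕ) : ℝ)) atTop
      (id : ℝ → ℝ) (fun τ => walkLaw θ θ₁ α β τ (2 * τ + (e + 1))) (limitLaw θ θ₁ α β) where
  forall_aemeasurable _ := by fun_prop
  tendsto := by
    refine ProbabilityMeasure.tendsto_iff_tendsto_charFun.2 fun ξ => ?_
    simp only [ProbabilityMeasure.coe_mk, Measure.map_id]
    exact tendsto_charFun_walkLaw θ₁ α β hs hc hαβ e ξ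

theorem limitLaw_real_Iic (hs : Real.sin θ ≠ 0) (hc : Real.cos θ ≠ 0)
    (hαβ : ‖α‖ ^ 2 + ‖β‖ ^ 2 = 1) (x : ℝ) :
    (limitLaw θ θ₁ α β).real (Set.Iic x) =
      (if 0 ≤ x then atom θ θ₁ else 0) + ∫ y in Set.Iic x, density θ θ₁ α β y := by
  have hd := density_nonneg θ₁ α β hc hαβ
  have h1 : (volume.withDensity fun x => ENNReal.ofReal (density θ θ₁ α β x)) (Set.Iic x) =
      ENNReal.ofReal (∫ y in Set.Iic x, density θ θ₁ α β y) := by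
    rw [withDensity_apply _ measurableSet_Iic,
      ofReal_integral_eq_lintegral_ofReal (integrable_density θ₁ α β hs hc).integrableOn
        (ae_of_all _ hd)]
  have h2 : (ENNReal.ofReal (atom θ θ₁) • Measure.dirac (0 : ℝ)) (Set.Iic x) =
      ENNReal.ofReal (if 0 ≤ x then atom θ θ₁ else 0) := by
    by_cases hx : 0 ≤ x <;> simp [hx]
  have h3 : 0 ≤ if 0 ≤ x then atom θ θ₁ else 0 := by
    split_ifs
    exacts [atom_nonneg θ θ₁, le_rfl]
  have h4 : 0 ≤ ∫ y in Set.Iic x, density θ θ₁ α β y := integral_nonneg hd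
  rw [measureReal_def, limitLaw, Measure.add_apply, h1, h2, ← ENNReal.ofReal_add h3 h4,
    ENNReal.toReal_ofReal (add_nonneg h3 h4)]

theorem limitLaw_singleton {x : ℝ} (hx : x ≠ 0 ∨ atom θ θ₁ = 0) :
    limitLaw θ θ₁ α β {x} = 0 := by
  rw [limitLaw, Measure.add_apply, withDensity_apply _ (measurableSet_singleton x)]
  rcases hx with hx | hx <;> simp [hx, Ne.symm]

end Limit

/-- Portmanteau theorem for the half-line, whose frontier is `{x}`. -/
theorem tendsto_real_Iic_of_tendstoInDistribution {Ω : ℕ → Type*}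
    {m : ∀ i, MeasurableSpace (Ω i)} {μ : ∀ i, Measure (Ω i)} [∀ i, IsProbabilityMeasure (μ i)]
    {ν : Measure ℝ} [IsProbabilityMeasure ν] {X : ∀ i, Ω i → ℝ}
    (h : TendstoInDistribution X atTop (id : ℝ → ℝ) μ ν) {x : ℝ} (hx : ν {x} = 0) :
    Tendsto (fun i => (μ i).real {ω | X i ω ≤ x}) atTop (𝓝 (ν.real (Set.Iic x))) := by
  have h1 := ProbabilityMeasure.tendsto_measure_of_null_frontier_of_tendsto' h.tendsto
    (E := Set.Iic x) (by simpa [frontier_Iic] using hx)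
  simp only [ProbabilityMeasure.coe_mk, Measure.map_id] at h1
  refine ((ENNReal.tendsto_toReal (measure_ne_top ν _)).comp h1).congr fun i => ?_
  simp only [Function.comp_apply]
  rw [Measure.map_apply_of_aemeasurable (h.forall_aemeasurable i) measurableSet_Iic]
  rfl

end HalfTimeQW

theorem theorem2 (θ θ₁ : ℝ) (α β : ℂ)
    (hθ : θ ∈ Set.Ico 0 (2 * Real.pi))
    (hθ0 : θ ≠ 0) (hθ1 : θ ≠ Real.pi / 2) (hθ2 : θ ≠ Real.pi) (hθ3 : θ ≠ 3 * Real.pi / 2)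
    (hθ₁ : θ₁ ∈ Set.Ico 0 (2 * Real.pi))
    (hαβ : ‖α‖ ^ 2 + ‖β‖ ^ 2 = 1) :
    -- the density is a genuine (nonnegative, integrable) one
    (∀ x, 0 ≤ density θ θ₁ α β x) ∧ Integrable (density θ θ₁ α β) ∧
    -- `X_t / t` converges in distribution to `Δ δ₀ + density(x) dx`, along the times `2τ+1`, `2τ+2`
    (∃ (_ : ∀ τ t : ℕ, IsProbabilityMeasure (walkLaw θ θ₁ α β τ t))
        (_ : IsProbabilityMeasure (limitLaw θ θ₁ α β)),
      ∀ e ∈ ({1, 2} : Set ℕ),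
        TendstoInDistribution (fun (τ : ℕ) (ω : ℤ) => (ω : ℝ) / ((2 * τ + e : ℕ) : ℝ)) atTop
          (id : ℝ → ℝ) (fun τ => walkLaw θ θ₁ α β τ (2 * τ + e)) (limitLaw θ θ₁ α β)) ∧
    -- the distribution functions converge at every continuity point of the limit
    (∀ e ∈ ({1, 2} : Set ℕ), ∀ x : ℝ, (x ≠ 0 ∨ atom θ θ₁ = 0) →
      Tendsto
        (fun τ : ℕ => (walkLaw θ θ₁ α β τ (2 * τ + e)).real
          {ω : ℤ | (ω : ℝ) / ((2 * τ + e : ℕ) : ℝ) ≤ x})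
        atTop
        (𝓝 ((if 0 ≤ x then atom θ θ₁ else 0) + ∫ y in Set.Iic x, density θ θ₁ α β y))) ∧
    -- for `θ₁ = θ` the limit law is that of the usual walk
    (θ₁ = θ → atom θ θ₁ = 0 ∧ density θ θ₁ α β = usualDensity θ α β) := by
  have hpi := Real.pi_pos
  -- Within `[0, 2π)` the excluded angles are exactly the zeros of `sin` and `cos`; the range of `θ`
  -- leaves only the multiples `n = 0, 1` to rule out in each case.
  have hs : Real.sin θ ≠ 0 := by
    rw [Real.sin_ne_zero_iff]
    rintro n rfl
    have h1 : (-1 : ℝ) < n := by nlinarith [hθ.1]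
    have h2 : (n : ℝ) < 2 := by nlinarith [hθ.2]
    have h3 : -1 < n := by exact_mod_cast h1
    have h4 : n < 2 := by exact_mod_cast h2
    interval_cases n <;> simp at hθ0 hθ2
  have hc : Real.cos θ ≠ 0 := by
    rw [Real.cos_ne_zero_iff]
    rintro n rfl
    have h1 : (-1 : ℝ) < n := by nlinarith [hθ.1]
    have h2 : (n : ℝ) < 2 := by nlinarith [hθ.2]
    have h3 : -1 < n := by exact_mod_cast h1
    have h4 : n < 2 := by exact_mod_cast h2
    interval_cases n
    · simp at hθ1
    · exact hθ3 (by push_cast; ring)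
  have hW := fun τ => isProbabilityMeasure_walkLaw θ θ₁ α β τ hαβ
  have hL := isProbabilityMeasure_limitLaw θ₁ α β hs hc hαβ
  have hT : ∀ e ∈ ({1, 2} : Set ℕ),
      TendstoInDistribution (fun (τ : ℕ) (ω : ℤ) => (ω : ℝ) / ((2 * τ + e : ℕ) : ℝ)) atTop
        (id : ℝ → ℝ) (fun τ => walkLaw θ θ₁ α β τ (2 * τ + e)) (limitLaw θ θ₁ α β) := by
    rintro e (rfl | rfl)
    · exact tendstoInDistribution_walkLaw θ₁ α β hs hc hαβ 0
    · exact tendstoInDistribution_walkLaw θ₁ α β hs hc hαβ 1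
  refine ⟨density_nonneg θ₁ α β hc hαβ, integrable_density θ₁ α β hs hc, ⟨hW, hL, hT⟩,
    fun e he x hx => ?_, ?_⟩
  · rw [← limitLaw_real_Iic θ₁ α β hs hc hαβ]
    exact tendsto_real_Iic_of_tendstoInDistribution (hT e he)
      (limitLaw_singleton θ₁ α β hx)
  · rintro rfl
    exact ⟨by simp [atom, mul_comm], density_self α β hc⟩
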